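/- **Conventions.** Let $a=(a_1,\dots,a_n)$ be a weak composition (a sequence of nonnegative integers). Its skyline diagram has $a_i$ left-justified boxes in row $i$, row $1$ being the lowest; columns are numbered $1,2,\dots$. A *set-valued filling* assigns to each box a non-empty finite set of positive integers; the maximum of a box is its *anchor*, all other entries are *free*. A *triple* consists of boxes $\beta,\alpha$ adjacent in a row ($\beta$ left of $\alpha$) and a box $\gamma$ such that either (A) $\gamma$ is above $\alpha$ in the same column and the lower of the two rows is weakly longer, or (B) $\gamma$ is below $\beta$ in the same column and the higher row is strictly longer; it is an *inversion triple* if its anchors satisfy $\gamma<\alpha\le\beta$ or $\alpha\le\beta<\gamma$. Consider the conditions: - (S.1) entries do not repeat in a column; - (S.2) rows are weakly decreasing, where $A\ge B$ means $\min A\ge\max B$; - (S.3) every triple of anchors is an inversion triple; - (S.4) each free entry $k$ lies in the cell of least anchor among the cells of its column with anchor greater than $k$ to which $k$ can be added without violating (S.2). Let $\overline{\mathrm{A}}(a)$ be the set of set-valued fillings of shape $a$ satisfying (S.1)–(S.4) in which each anchor in the first column equals its row index. Let $\overline{\mathrm{K}}(a)$ be the set of set-valued fillings of the reversed shape $(a_n,\dots,a_1)$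 which satisfy (S.1)–(S.4) when augmented by a column $0$ (the basement) with entry $n-i+1$ in every row $i$; the basement is not counted in column sets and weights. Let $\mathrm{A}(a)\subseteq\overline{\mathrm{A}}(a)$ (atom skyline fillings) and $\mathrm{K}(a)\subseteq\overline{\mathrm{K}}(a)$ (key skyline fillings) be the subsets of fillings with exactly one number in each box. Let $\mathtt{lswap}(a)$ be the set of weak compositions obtained from $a$ by a possibly empty sequence of exchanges of two entries $a_i\le a_j$ with $i<j$. For $T\in\mathrm{K}(a)$ define the *left row-filling* $\psi(T)$: let $i_1$ be the least entry in column $1$ of $T$ and, for $k>1$, let $i_k$ be the greatest entry in column $k$ that is at most $i_{k-1}$, stopping when there is none. Place $i_1,i_2,\dots$ in row $i_1$ of $\psi(T)$, delete them from $T$, and repeat with what remains. For $\overline T\in\overline{\mathrm{K}}(a)$, let $T$ be obtained by deleting all free entries, and let $\overline\psi(\overline T)$ be obtained from $\psi(T)$ by placing each free entry of $\overline T$, in its own column, in the cell of smallest anchor exceeding it to which it can be added without violating (S.2). **Theorem.** For every weak composition $a$, the left row-filling is a well-defined bijection $$\psi:\mathrm{K}(a)\longrightarrow\coprod_{b\in\mathtt{lswap}(a)}\mathrm{A}(b),$$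 and it preserves the set of entries of each column, hence also the weight (the number of occurrences of each integer). Moreover $\overline\psi$ is a well-defined bijection $$\overline\psi:\overline{\mathrm{K}}(a)\longrightarrow\coprod_{b\in\mathtt{lswap}(a)}\overline{\mathrm{A}}(b)$$ which extends $\psi$ and also preserves the set of entries of each column and the weight. -/

import Mathlib

namespace Skyline

/-! Weak compositions of length `n` are functions `Fin n → ℕ`.  Row `i : Fin n` of a diagram is the
row with index `i + 1`, row `1` being the lowest.  Columns are numbered from `1`, left to right;
column `0` is reserved for a basement. -/

/-- A left swap exchanges two entries `a i ≤ a j` with `i < j`. -/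
def LeftSwap {n : ℕ} (a b : Fin n → ℕ) : Prop :=
  ∃ i j : Fin n, i < j ∧ a i ≤ a j ∧ b = a ∘ Equiv.swap i j

/-- Weak compositions obtained from `a` by a possibly empty sequence of left swaps. -/
def lswap {n : ℕ} (a : Fin n → ℕ) : Set (Fin n → ℕ) :=
  {b | Relation.ReflTransGen LeftSwap a b}

/-- A set-valued filling: `F i c` is the set of entries in row `i`, column `c`; the set is empty
exactly when there is no box in this position. -/
abbrev Filling (n : ℕ) := Fin n → ℕ → Finset ℕ

/-- `F` is a filling of the skyline diagram of `a` by non-empty sets of positive integers. -/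
def IsFillingOf {n : ℕ} (a : Fin n → ℕ) (F : Filling n) : Prop :=
  (∀ i c, (F i c).Nonempty ↔ 1 ≤ c ∧ c ≤ a i) ∧ ∀ i c, ∀ x ∈ F i c, 0 < x

/-- The filling `F` augmented on the left by a basement (column `0`) with entry `b i` in row `i`. -/
def withBasement {n : ℕ} (b : Fin n → ℕ) (F : Filling n) : Filling n :=
  fun i c => if c = 0 then {b i} else F i c

/-- The anchor (maximum entry) of a box; it is `0` if there is no box. -/
def anchor {n : ℕ} (F : Filling n) (i : Fin n) (c : ℕ) : ℕ := (F i c).sup id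

/-- Entries do not repeat in a column. -/
def ColumnsDistinct {n : ℕ} (F : Filling n) : Prop :=
  ∀ c i j, i ≠ j → Disjoint (F i c) (F j c)

/-- Rows are weakly decreasing, where `A ≥ B` means `min A ≥ max B`. -/
def RowsDecreasing {n : ℕ} (F : Filling n) : Prop :=
  ∀ i c, ∀ x ∈ F i c, ∀ y ∈ F i (c + 1), y ≤ x

/-- The inversion condition on the labels of a triple. -/
def IsInversion (α β γ : ℕ) : Prop := (γ < α ∧ α ≤ β) ∨ (α ≤ β ∧ β < γ)

/-- Every triple of anchors is an inversion triple.  The row lengths are given by `a`, and `i` is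
the lower of the two rows involved. In type A, the third box is above the right box and the lower
row is weakly longer; in type B, the third box is below the left box and the higher row is strictly
longer. -/
def TriplesInversion {n : ℕ} (a : Fin n → ℕ) (F : Filling n) : Prop :=
  ∀ i j : Fin n, i < j → ∀ c,
    (a j ≤ a i → (F i c).Nonempty → (F i (c + 1)).Nonempty → (F j (c + 1)).Nonempty →
      IsInversion (anchor F i (c + 1)) (anchor F i c) (anchor F j (c + 1))) ∧
    (a i < a j → (F j c).Nonempty → (F j (c + 1)).Nonempty → (F i c).Nonempty →
      IsInversion (anchor F j (c + 1)) (anchor F j c) (anchor F i c))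

/-- The filling `F` with the entry `k` added to the box in row `i`, column `c`. -/
def addEntry {n : ℕ} (F : Filling n) (i : Fin n) (c k : ℕ) : Filling n :=
  fun i' c' => if i' = i ∧ c' = c then insert k (F i c) else F i' c'

/-- The number `k` can be placed as a free entry in the box in row `i`, column `c` of `F` without
violating the decreasingness of rows. -/
def Admits {n : ℕ} (F : Filling n) (i : Fin n) (c k : ℕ) : Prop :=
  k < anchor F i c ∧ RowsDecreasing (addEntry F i c k)

/-- Each free entry is in the cell of the least anchor in its column which admits it. -/
def FreeEntriesLeast {n : ℕ} (F : Filling n) : Prop :=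
  ∀ i c, ∀ k ∈ F i c, k < anchor F i c → ∀ j, Admits F j c k → anchor F i c ≤ anchor F j c

/-- The conditions for semistandardness shared by fillings with and without basement. -/
structure IsSemistandard {n : ℕ} (a : Fin n → ℕ) (F : Filling n) : Prop where
  columnsDistinct : ColumnsDistinct F
  rowsDecreasing : RowsDecreasing F
  triplesInversion : TriplesInversion a F
  freeEntriesLeast : FreeEntriesLeast F

/-- Exactly one number in each box. -/
def SingleValued {n : ℕ} (F : Filling n) : Prop := ∀ i c, (F i c).card ≤ 1

/-- Semistandard set-valued skyline fillings of shape `a` (no basement), with anchors in the first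
column equal to their row index. -/
def lascouxAtomSSF {n : ℕ} (a : Fin n → ℕ) : Set (Filling n) :=
  {F | IsFillingOf a F ∧ IsSemistandard a F ∧ ∀ i, (F i 1).Nonempty → anchor F i 1 = i.val + 1}

/-- The atom skyline fillings of shape `a`: one number in each box. -/
def atomSSF {n : ℕ} (a : Fin n → ℕ) : Set (Filling n) :=
  {F | F ∈ lascouxAtomSSF a ∧ SingleValued F}

/-- Semistandard set-valued skyline fillings of the reversed shape `(a_n, …, a_1)` with basement
entry `n - r + 1` in the row with index `r`.  The basement, being fixed, is not recorded. -/
def lascouxSSF {n : ℕ} (a : Fin n → ℕ) : Set (Filling n) :=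
  {F | IsFillingOf (a ∘ Fin.rev) F ∧
    IsSemistandard (a ∘ Fin.rev) (withBasement (fun i => n - i.val) F)}

/-- The key skyline fillings of `a`: one number in each box. -/
def keySSF {n : ℕ} (a : Fin n → ℕ) : Set (Filling n) :=
  {F | F ∈ lascouxSSF a ∧ SingleValued F}

/-- The set of entries in column `c`. -/
def columnSet {n : ℕ} (F : Filling n) (c : ℕ) : Finset ℕ :=
  Finset.univ.biUnion fun i => F i c

/-- The weight: the number of occurrences of `v`, for each `v`. -/
noncomputable def weight {n : ℕ} (F : Filling n) (v : ℕ) : ℕ :=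
  {p : Fin n × ℕ | v ∈ F p.1 p.2}.ncard

/-- The sequence `i₁, i₂, …` extracted from a family `C` of column sets: `i₁` is the least element
of column `1`, and `i_k` is the greatest element of column `k` that is weakly less than `i_{k-1}`;
`none` indicates that the sequence has terminated. -/
def threadEntry (C : ℕ → Finset ℕ) : ℕ → Option ℕ
  | 0 => none
  | 1 => if h : (C 1).Nonempty then some ((C 1).min' h) else none
  | k + 2 =>
    match threadEntry C (k + 1) with
    | none => none
    | some m =>
      if h : ((C (k + 2)).filter (· ≤ m)).Nonempty then
        some (((C (k + 2)).filter (· ≤ m)).max' h)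
      else none

/-- What remains of the column sets after deleting the first `m` extracted sequences. -/
def remaining (C : ℕ → Finset ℕ) : ℕ → ℕ → Finset ℕ
  | 0 => C
  | m + 1 => fun c => (remaining C m c).filter fun x => threadEntry (remaining C m) c ≠ some x

/-- Left row-filling, the map `ψ`: each extracted sequence `i₁, i₂, …` is placed, in this order, in
the row with index `i₁`.  (As each sequence uses one entry of column `1`, there are as many
sequences as entries in column `1`.) -/
def leftRowFilling {n : ℕ} (T : Filling n) : Filling n :=
  fun i c => (columnSet T c).filter fun x =>
    ∃ m < (columnSet T 1).card,
      threadEntry (remaining (columnSet T) m) 1 = some (i.val + 1) ∧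
      threadEntry (remaining (columnSet T) m) c = some x

/-- The filling obtained by deleting all free entries. -/
def anchors {n : ℕ} (F : Filling n) : Filling n :=
  fun i c => (F i c).filter fun x => x = anchor F i c

/-- The free entries of column `c`. -/
def freeSet {n : ℕ} (F : Filling n) (c : ℕ) : Finset ℕ :=
  Finset.univ.biUnion fun i => (F i c).filter fun x => x < anchor F i c

open Classical in
/-- The set-valued left row-filling: apply `ψ` to the filling of anchors, then place each free entry
with the smallest possible anchor in its column, subject to the decreasingness of rows. -/
noncomputable def setValuedLeftRowFilling {n : ℕ} (T : Filling n) : Filling n :=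
  fun i c =>
    leftRowFilling (anchors T) i c ∪
      (freeSet T c).filter fun k =>
        Admits (leftRowFilling (anchors T)) i c k ∧
        ∀ j, Admits (leftRowFilling (anchors T)) j c k →
          anchor (leftRowFilling (anchors T)) i c ≤ anchor (leftRowFilling (anchors T)) j c

end Skyline

namespace Skyline

/-! The left row-filling depends only on the column sets of its argument, so everything is organised
around families of column sets. A one-number-per-box filling is encoded as a table: rows are
labelled by basement entries (for key fillings this reverses the rows), and rows decrease weakly. In
these terms key and atom fillings are two normal forms of a table, cut out by `KeyLike` and
`AtomLike`.

Each normal form exists and is unique for given columns. Exchanging two rows in suitable columns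
removes a violation and lowers a weighted sum of entries. This brings any table of shape `a` to a
key table of shape `a` (`exists_keyLike`) and to an atom table whose shape is in `lswap a`
(`exists_atomLike`). Conversely, sorting pairs of rows undoes left swaps
(`exists_isTable_of_mem_lswap`). A key table of given shape is determined by its columns, by
counting large entries in adjacent columns (`KeyLike.eq`). An atom table is determined by its
columns, shape included, because the extraction algorithm reads off its rows one at a time
(`AtomLike.leftRowFilling_eq`). Hence the algorithm, applied to a key filling, returns the atom
filling with the same columns, and this is a bijection.

A set-valued filling amounts to its anchors together with the free entries of each column, since
(S.4) dictates where the latter go. Whether a number fits into a column depends only on how many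
anchors exceed it there and in the next column (`exists_admits_of_sameColumns`), so the same free
entries can be placed on both sides. -/

variable {n : ℕ}

/-! ### Tables and exchanges of two rows in selected columns -/

/-- A filling with one number in each box as an array of numbers, `0` meaning that there is no box.
Rows are labelled by their basement entry, which is recorded in column `0`. -/
structure IsTable (a : Fin n → ℕ) (z : Fin n → ℕ → ℕ) : Prop where
  zero : ∀ r, z r 0 = r.val + 1
  anti : ∀ r c, z r (c + 1) ≤ z r c
  pos : ∀ r c, 0 < z r c ↔ c ≤ a r
  inj : ∀ c q p, 0 < z q c → z q c = z p c → q = p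

/-- The triple conditions for a key skyline filling. -/
def KeyLike (a : Fin n → ℕ) (z : Fin n → ℕ → ℕ) : Prop :=
  ∀ q p, q < p → ∀ c,
    (a q ≤ a p → 0 < z q c → z q c < z p c) ∧
    (a p < a q → 0 < z p c → z p c < z q c → z p c < z q (c + 1))

/-- The triple conditions for an atom skyline filling, in a form which does not refer to the
shape. -/
def AtomLike (z : Fin n → ℕ → ℕ) : Prop :=
  ∀ q p, q < p → ∀ c, z p (c + 1) ≤ z q (c + 1) ∨ z q c < z p (c + 1)

def SameColumns (z w : Fin n → ℕ → ℕ) : Prop :=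
  ∀ c v, 0 < v → ((∃ r, z r c = v) ↔ ∃ r, w r c = v)

theorem SameColumns.refl (z : Fin n → ℕ → ℕ) : SameColumns z z := fun _ _ _ => Iff.rfl

theorem SameColumns.symm {z w : Fin n → ℕ → ℕ} (h : SameColumns z w) : SameColumns w z :=
  fun c v hv => (h c v hv).symm

theorem SameColumns.trans {z w u : Fin n → ℕ → ℕ} (h : SameColumns z w) (h' : SameColumns w u) :
    SameColumns z u :=
  fun c v hv => (h c v hv).trans (h' c v hv)

open Classical in
/-- Exchange the rows `q` and `p` in the columns satisfying `J`. -/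
noncomputable def swapOn (z : Fin n → ℕ → ℕ) (q p : Fin n) (J : ℕ → Prop) : Fin n → ℕ → ℕ :=
  fun r c => if J c then z (Equiv.swap q p r) c else z r c

theorem swapOn_comm (z : Fin n → ℕ → ℕ) (q p : Fin n) (J : ℕ → Prop) :
    swapOn z q p J = swapOn z p q J := by
  unfold swapOn; rw [Equiv.swap_comm]

theorem sameColumns_swapOn (z : Fin n → ℕ → ℕ) (q p : Fin n) (J : ℕ → Prop) :
    SameColumns z (swapOn z q p J) := by
  intro c v _
  unfold swapOn
  by_cases h : J c
  · simp only [h, if_true]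
    exact ⟨fun ⟨r, hr⟩ => ⟨Equiv.swap q p r, by simpa using hr⟩, fun ⟨r, hr⟩ => ⟨_, hr⟩⟩
  · simp only [h, if_false]

/-- Between two columns on the same side of `J` the rows are merely relabelled, so monotonicity has
to be checked only where `J` changes, and there crosswise. -/
theorem IsTable.swapOn {a a' : Fin n → ℕ} {z : Fin n → ℕ → ℕ} (hz : IsTable a z) {q p : Fin n}
    {J : ℕ → Prop} (h0 : ¬ J 0)
    (hJ : ∀ c, ¬ (J c ↔ J (c + 1)) → z p (c + 1) ≤ z q c ∧ z q (c + 1) ≤ z p c)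
    (ha : ∀ r, r ≠ q → r ≠ p → a' r = a r)
    (hq : ∀ c, (J c → (0 < z p c ↔ c ≤ a' q)) ∧ (¬ J c → (0 < z q c ↔ c ≤ a' q)))
    (hp : ∀ c, (J c → (0 < z q c ↔ c ≤ a' p)) ∧ (¬ J c → (0 < z p c ↔ c ≤ a' p))) :
    IsTable a' (swapOn z q p J) := by
  refine ⟨fun r => ?_, fun r c => ?_, fun r c => ?_, fun c r s hr hrs => ?_⟩
  · simp [Skyline.swapOn, h0, hz.zero]
  · have h := hz.anti
    have h1 := hJ c
    unfold Skyline.swapOn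
    by_cases e1 : J c <;> by_cases e2 : J (c + 1) <;>
      simp only [e1, e2, if_true, if_false, iff_true, iff_false, not_true,
        not_false_eq_true, true_implies] at h1 ⊢
    · exact h _ _
    · rcases eq_or_ne r q with rfl | hq'
      · simpa using h1.2
      rcases eq_or_ne r p with rfl | hp'
      · simpa using h1.1
      rw [Equiv.swap_apply_of_ne_of_ne hq' hp']; exact h _ _
    · rcases eq_or_ne r q with rfl | hq'
      · simpa using h1.1
      rcases eq_or_ne r p with rfl | hp'
      · simpa using h1.2
      rw [Equiv.swap_apply_of_ne_of_ne hq' hp']; exact h _ _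
    · exact h _ _
  · unfold Skyline.swapOn
    rcases eq_or_ne r q with rfl | hq'
    · by_cases e : J c
      · simpa [e] using (hq c).1 e
      · simpa [e] using (hq c).2 e
    rcases eq_or_ne r p with rfl | hp'
    · by_cases e : J c
      · simpa [e] using (hp c).1 e
      · simpa [e] using (hp c).2 e
    rw [Equiv.swap_apply_of_ne_of_ne hq' hp', ite_self, ha r hq' hp']
    exact hz.pos _ _
  · unfold Skyline.swapOn at hr hrs
    by_cases e : J c <;> simp only [e, if_true, if_false] at hr hrs
    · exact (Equiv.swap q p).injective (hz.inj c _ _ hr hrs)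
    · exact hz.inj c _ _ hr hrs

/-! ### Existence of key and atom tables, by descent -/

/-- A weighted sum of the entries in the first `N` columns. -/
def potential (w : Fin n → ℕ) (N : ℕ) (z : Fin n → ℕ → ℕ) : ℕ :=
  ∑ c ∈ Finset.range N, ∑ r, w r * z r c

theorem sum_mul_swap_lt (w f : Fin n → ℕ) {i j : Fin n} (hw : w i < w j) (hf : f i < f j) :
    ∑ r, w r * f (Equiv.swap i j r) < ∑ r, w r * f r := by
  have hij : i ≠ j := by rintro rfl; exact lt_irrefl _ hw
  zify
  rw [← sub_pos, ← Finset.sum_sub_distrib,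
    Finset.sum_eq_add (a := i) (b := j) hij
      (fun c _ hc => by rw [Equiv.swap_apply_of_ne_of_ne hc.1 hc.2, sub_self])
      (by simp) (by simp)]
  -- The difference of the two sums is `(w j - w i) * (f j - f i)`.
  simp only [Equiv.swap_apply_left, Equiv.swap_apply_right]
  zify at hw hf
  nlinarith

theorem potential_swapOn_lt {w : Fin n → ℕ} {N : ℕ} {z : Fin n → ℕ → ℕ} {q p : Fin n}
    {J : ℕ → Prop} (hw : w q < w p) (hJ : ∀ c, J c → z q c < z p c) {c : ℕ} (hc : c < N)
    (hc' : J c) : potential w N (swapOn z q p J) < potential w N z := by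
  unfold potential
  apply Finset.sum_lt_sum
  · intro m _
    by_cases e : J m
    · simpa [swapOn, e] using (sum_mul_swap_lt w (fun r => z r m) hw (hJ m e)).le
    · simp [swapOn, e]
  · exact ⟨c, Finset.mem_range.2 hc, by
      simpa [swapOn, hc'] using sum_mul_swap_lt w (fun r => z r c) hw (hJ c hc')⟩

theorem exists_and_of_descent {α : Type*} {P Q : α → Prop} (μ : α → ℕ)
    (step : ∀ x, P x → ¬ Q x → ∃ y, P y ∧ μ y < μ x) (h : ∃ x, P x) : ∃ x, P x ∧ Q x := by
  obtain ⟨x, hx⟩ := h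
  induction hm : μ x using Nat.strong_induction_on generalizing x with
  | _ m ih =>
    by_cases hq : Q x
    · exact ⟨x, hx, hq⟩
    · obtain ⟨y, hy, hlt⟩ := step x hx hq
      exact ih _ (hm ▸ hlt) y hy rfl

/-- The bound comes from the initial table alone, so one cut-off for the potential serves the whole
descent even when the shape changes on the way. -/
theorem SameColumns.lt_of_pos {a : Fin n → ℕ} {z z₀ : Fin n → ℕ → ℕ} (h₀ : IsTable a z₀)
    (h : SameColumns z₀ z) {r : Fin n} {c : ℕ} (hc : 0 < z r c) : c < Finset.univ.sup a + 1 := by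
  obtain ⟨s, hs⟩ := (h c _ hc).2 ⟨r, rfl⟩
  have := (h₀.pos s c).1 (hs ▸ hc)
  exact Nat.lt_succ_of_le (this.trans (Finset.le_sup (Finset.mem_univ s)))

/-- Columnwise minima and maxima of two weakly decreasing rows are weakly decreasing. The basement
is already sorted, so column `0` is untouched. -/
theorem IsTable.sort {a a' : Fin n → ℕ} {z : Fin n → ℕ → ℕ} (hz : IsTable a z) {q p : Fin n}
    (hqp : q < p) (ha : ∀ r, r ≠ q → r ≠ p → a' r = a r) (hq : a' q = min (a q) (a p))
    (hp : a' p = max (a q) (a p)) : IsTable a' (Skyline.swapOn z q p fun c => z p c < z q c) := by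
  refine hz.swapOn ?_ (fun c hc => ?_) ha (fun c => ?_) (fun c => ?_)
  · rw [hz.zero, hz.zero]; have : q.val < p.val := hqp; omega
  · have h1 := hz.anti q c
    have h2 := hz.anti p c
    constructor <;> by_contra <;> apply hc <;> omega
  · have h1 := hz.pos q c
    have h2 := hz.pos p c
    rw [hq]
    constructor <;> intro <;> omega
  · have h1 := hz.pos q c
    have h2 := hz.pos p c
    rw [hp]
    constructor <;> intro <;> omega

/-- Each exchange moves larger entries to the row with larger label, where the weight `n - r` is
smaller, so the potential drops. -/
theorem exists_keyLike {a : Fin n → ℕ} {z₀ : Fin n → ℕ → ℕ} (h₀ : IsTable a z₀) :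
    ∃ z, (IsTable a z ∧ SameColumns z₀ z) ∧ KeyLike a z := by
  have hw : ∀ q p : Fin n, q < p → n - p.val < n - q.val := fun q p h => by
    have : q.val < p.val := h
    omega
  refine exists_and_of_descent
    (potential (fun r => n - r.val) (Finset.univ.sup a + 1)) ?_ ⟨z₀, h₀, SameColumns.refl _⟩
  rintro z ⟨hz, hc₀⟩ hk
  unfold KeyLike at hk
  push Not at hk
  obtain ⟨q, p, hqp, c, hk⟩ := hk
  have hcol := fun J => hc₀.trans (sameColumns_swapOn z q p J)
  by_cases hA : a q ≤ a p → 0 < z q c → z q c < z p c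
  · obtain ⟨h1, h2, h3, h4⟩ := hk hA
    -- The shorter row `p` violates the second condition at column `c`, that is `z q (c + 1) ≤ z p
    -- c`. This is exactly what allows the tails beyond column `c` to be exchanged, or equivalently
    -- the heads to be sorted. Both rows have boxes up to column `c`, so the shape stays.
    refine ⟨swapOn z q p fun m => m ≤ c ∧ z p m < z q m,
      ⟨hz.swapOn ?_ ?_ (fun _ _ _ => rfl) ?_ ?_, hcol _⟩, ?_⟩
    · rw [hz.zero, hz.zero]; have : q.val < p.val := hqp; omega
    · intro m hm
      have e1 := hz.anti q m
      have e2 := hz.anti p m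
      rcases lt_trichotomy m c with h | rfl | h
      · constructor <;> by_contra <;> apply hm <;> omega
      · omega
      · exact absurd (by constructor <;> omega) hm
    · intro m
      have e1 := hz.pos q m
      have e2 := hz.pos p m
      have e3 := hz.pos q c
      have e4 := hz.pos p c
      constructor <;> intro <;> omega
    · intro m
      have e1 := hz.pos q m
      have e2 := hz.pos p m
      have e3 := hz.pos q c
      have e4 := hz.pos p c
      constructor <;> intro <;> omega
    · rw [swapOn_comm]
      exact potential_swapOn_lt (hw q p hqp) (fun m hm => hm.2)
        (hc₀.lt_of_pos h₀ h2) ⟨le_rfl, h3⟩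
  · push Not at hA
    obtain ⟨h1, h2, h3⟩ := hA
    have h4 : z p c < z q c := lt_of_le_of_ne h3 fun e => hqp.ne' (hz.inj c p q (by omega) e)
    -- Since `a q ≤ a p`, sorting the two rows entirely preserves the shape.
    refine ⟨swapOn z q p fun m => z p m < z q m, ⟨hz.sort hqp (fun _ _ _ => rfl) ?_ ?_, hcol _⟩, ?_⟩
    · omega
    · omega
    · rw [swapOn_comm]
      exact potential_swapOn_lt (hw q p hqp) (fun m hm => hm) (hc₀.lt_of_pos h₀ h2) h4

/-- A left swap puts the longer of two rows below the shorter one; sorting the pair gives the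
original lengths back. -/
theorem exists_isTable_of_mem_lswap {a b : Fin n → ℕ} (hb : b ∈ lswap a) {z₀ : Fin n → ℕ → ℕ}
    (h₀ : IsTable b z₀) : ∃ z, IsTable a z ∧ SameColumns z₀ z := by
  induction hb generalizing z₀ with
  | refl => exact ⟨z₀, h₀, SameColumns.refl _⟩
  | tail _ h ih =>
    obtain ⟨i, j, hij, hle, rfl⟩ := h
    obtain ⟨z, hz, hz'⟩ := ih (h₀.sort hij (fun r h1 h2 => by
      rw [Function.comp_apply, Equiv.swap_apply_of_ne_of_ne h1 h2])
      (by simp [hle]) (by simp [hle]))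
    exact ⟨z, hz, (sameColumns_swapOn _ _ _ _).trans hz'⟩

/-- A violation at column `c` allows row `q` to continue with the entries of row `p`. Exchanging the
rows in the later columns where row `p` is larger moves large entries down, lowering the potential
with weight `r`. -/
theorem exists_atomLike {a : Fin n → ℕ} {z₀ : Fin n → ℕ → ℕ} (h₀ : IsTable a z₀) :
    ∃ z, (∃ b ∈ lswap a, IsTable b z ∧ SameColumns z₀ z) ∧ AtomLike z := by
  refine exists_and_of_descent
    (potential (fun r => r.val) (Finset.univ.sup a + 1)) ?_
    ⟨z₀, a, Relation.ReflTransGen.refl, h₀, SameColumns.refl _⟩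
  rintro z ⟨b, hb, hz, hc₀⟩ hk
  unfold AtomLike at hk
  push Not at hk
  obtain ⟨q, p, hqp, c, h1, h2⟩ := hk
  have hpot := potential_swapOn_lt (w := fun r : Fin n => r.val) (z := z) hqp
    (J := fun m => c < m ∧ z q m < z p m) (fun m hm => hm.2)
    (hc₀.lt_of_pos h₀ (by omega : 0 < z p (c + 1))) ⟨Nat.lt_succ_self c, h1⟩
  have hbd : ∀ m, ¬ ((c < m ∧ z q m < z p m) ↔ (c < m + 1 ∧ z q (m + 1) < z p (m + 1))) →
      z p (m + 1) ≤ z q m ∧ z q (m + 1) ≤ z p m := by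
    intro m hm
    have e1 := hz.anti q m
    have e2 := hz.anti p m
    rcases lt_trichotomy m c with h | rfl | h
    · exact absurd (by constructor <;> omega) hm
    · omega
    · constructor <;> by_contra <;> apply hm <;> omega
  have e3 := hz.pos q c
  have e4 := hz.pos p (c + 1)
  -- Row `q` ends up with the longer of the two tails: this is a left swap of the shape if `b q ≤ b
  -- p`, and leaves the shape alone otherwise.
  by_cases hle : b q ≤ b p
  · refine ⟨_, ⟨b ∘ Equiv.swap q p, hb.tail ⟨q, p, hqp, hle, rfl⟩, hz.swapOn (by simp) hbd
      (fun r h1 h2 => by rw [Function.comp_apply, Equiv.swap_apply_of_ne_of_ne h1 h2]) ?_ ?_,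
      hc₀.trans (sameColumns_swapOn _ _ _ _)⟩, hpot⟩
    · intro m
      have e1 := hz.pos q m
      have e2 := hz.pos p m
      simp only [Function.comp_apply, Equiv.swap_apply_left]
      constructor <;> intro <;> omega
    · intro m
      have e1 := hz.pos q m
      have e2 := hz.pos p m
      simp only [Function.comp_apply, Equiv.swap_apply_right]
      constructor <;> intro <;> omega
  · refine ⟨_, ⟨b, hb, hz.swapOn (by simp) hbd (fun _ _ _ => rfl) ?_ ?_,
      hc₀.trans (sameColumns_swapOn _ _ _ _)⟩, hpot⟩
    · intro m
      have e1 := hz.pos q m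
      have e2 := hz.pos p m
      constructor <;> intro <;> omega
    · intro m
      have e1 := hz.pos q m
      have e2 := hz.pos p m
      constructor <;> intro <;> omega

/-! ### Counting large entries, and uniqueness of key tables -/

theorem SameColumns.image_filter_lt {z w : Fin n → ℕ → ℕ} (h : SameColumns z w) (c v : ℕ) :
    (Finset.univ.filter fun r => v < z r c).image (z · c) =
      (Finset.univ.filter fun r => v < w r c).image (w · c) := by
  ext x
  simp only [Finset.mem_image, Finset.mem_filter, Finset.mem_univ, true_and]
  constructor
  · rintro ⟨r, hr, rfl⟩
    obtain ⟨s, hs⟩ := (h c _ (by omega)).1 ⟨r, rfl⟩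
    exact ⟨s, hs ▸ hr, hs⟩
  · rintro ⟨r, hr, rfl⟩
    obtain ⟨s, hs⟩ := (h c _ (by omega)).2 ⟨r, rfl⟩
    exact ⟨s, hs ▸ hr, hs⟩

theorem IsTable.injOn {a : Fin n → ℕ} {z : Fin n → ℕ → ℕ} (hz : IsTable a z) (c v : ℕ) :
    Set.InjOn (z · c) (Finset.univ.filter fun r => v < z r c) := by
  intro r hr s _ h
  simp only [Finset.coe_filter, Finset.mem_univ, true_and, Set.mem_ofPred_eq] at hr
  exact hz.inj c r s (by omega) h

theorem SameColumns.card_filter_lt {a b : Fin n → ℕ} {z w : Fin n → ℕ → ℕ} (h : SameColumns z w)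
    (hz : IsTable a z) (hw : IsTable b w) (c v : ℕ) :
    (Finset.univ.filter fun r => v < z r c).card = (Finset.univ.filter fun r => v < w r c).card := by
  rw [← Finset.card_image_of_injOn (hz.injOn c v), ← Finset.card_image_of_injOn (hw.injOn c v),
    h.image_filter_lt]

theorem SameColumns.card_filter_le_lt {a b : Fin n → ℕ} {z w : Fin n → ℕ → ℕ}
    (h : SameColumns z w) (hz : IsTable a z) (hw : IsTable b w) {p : Fin n}
    (hp : ∀ r, p < r → z r = w r) (c v : ℕ) :
    ((Finset.univ.filter fun r => v < z r c).filter fun r => r ≤ p).card =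
      ((Finset.univ.filter fun r => v < w r c).filter fun r => r ≤ p).card := by
  have h1 := Finset.card_filter_add_card_filter_not (s := Finset.univ.filter fun r => v < z r c)
    (fun r => r ≤ p)
  have h2 := Finset.card_filter_add_card_filter_not (s := Finset.univ.filter fun r => v < w r c)
    (fun r => r ≤ p)
  have h3 : ((Finset.univ.filter fun r => v < z r c).filter fun r => ¬ r ≤ p) =
      (Finset.univ.filter fun r => v < w r c).filter fun r => ¬ r ≤ p := by
    ext r
    simp only [Finset.mem_filter, Finset.mem_univ, true_and, not_le]
    exact ⟨fun ⟨h, h'⟩ => ⟨hp r h' ▸ h, h'⟩, fun ⟨h, h'⟩ => ⟨(hp r h').symm ▸ h, h'⟩⟩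
  have h4 := h.card_filter_lt hz hw c v
  rw [h3] at h1
  omega

/-- Count entries exceeding `v = z p c` in rows up to `p`. In `z`, the key conditions force every
row counted in column `c` to be counted in column `c + 1` as well. If `v < w p c`, then in `w` row
`p` is counted in column `c` but not in column `c + 1`, so the count strictly falls. But the counts
of `z` and `w` agree. -/
theorem KeyLike.not_apply_lt {a : Fin n → ℕ} {z w : Fin n → ℕ → ℕ} (hk : KeyLike a z)
    (h : SameColumns z w) (hz : IsTable a z) (hw : IsTable a w) {p : Fin n}
    (hp : ∀ r, p < r → z r = w r) {c : ℕ} (hc : z p (c + 1) = w p (c + 1)) :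
    ¬ z p c < w p c := by
  intro hlt
  have hpos : 0 < z p c := (hz.pos p c).2 ((hw.pos p c).1 (by omega))
  have h1 : ((Finset.univ.filter fun r => z p c < z r c).filter fun r => r ≤ p) ⊆
      (Finset.univ.filter fun r => z p c < z r (c + 1)).filter fun r => r ≤ p := by
    intro r
    simp only [Finset.mem_filter, Finset.mem_univ, true_and]
    rintro ⟨hr, hrp⟩
    have hrp' : r < p := lt_of_le_of_ne hrp (by rintro rfl; exact lt_irrefl _ hr)
    have := hk r p hrp' c
    refine ⟨this.2 (not_le.1 fun hle => ?_) hpos hr, hrp⟩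
    have := this.1 hle (by omega)
    omega
  have h2 : ((Finset.univ.filter fun r => z p c < w r (c + 1)).filter fun r => r ≤ p) ⊂
      (Finset.univ.filter fun r => z p c < w r c).filter fun r => r ≤ p := by
    refine (Finset.ssubset_iff_of_subset fun r => ?_).2 ⟨p, ?_, ?_⟩
    · simp only [Finset.mem_filter, Finset.mem_univ, true_and]
      exact fun ⟨hr, hrp⟩ => ⟨hr.trans_le (hw.anti r c), hrp⟩
    · simpa using hlt
    · simpa [← hc] using hz.anti p c
  have h3 := Finset.card_le_card h1
  have h4 := Finset.card_lt_card h2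
  rw [h.card_filter_le_lt hz hw hp, h.card_filter_le_lt hz hw hp] at h3
  omega

/-- Rows are compared from the last to the first, and within a row the columns from right to left,
starting beyond the end of the row. -/
theorem KeyLike.eq {a : Fin n → ℕ} {z w : Fin n → ℕ → ℕ} (hkz : KeyLike a z) (hkw : KeyLike a w)
    (h : SameColumns z w) (hz : IsTable a z) (hw : IsTable a w) : z = w := by
  funext p
  induction p using WellFoundedGT.induction with
  | _ p ih =>
    have : ∀ k c, a p < c + k → z p c = w p c := by
      intro k
      induction k with
      | zero =>
        intro c hc
        have h1 := hz.pos p c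
        have h2 := hw.pos p c
        omega
      | succ k ihk =>
        intro c hc
        have h1 := ihk (c + 1) (by omega)
        exact le_antisymm
          (not_lt.1 (hkw.not_apply_lt h.symm hw hz (fun r hr => (ih r hr).symm) h1.symm))
          (not_lt.1 (hkz.not_apply_lt h hz hw ih h1))
    funext c
    exact this (a p + 1) c (by omega)

/-! ### The extraction algorithm recovers an atom table from its columns -/

/-- The filling with the positive numbers of `z` in columns `1, 2, …` as its entries. -/
def toFilling (z : Fin n → ℕ → ℕ) : Filling n :=
  fun r c => ({z r c} : Finset ℕ).filter fun x => c ≠ 0 ∧ 0 < x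

/-- The column sets of the rows in `P`. -/
def colsOf (z : Fin n → ℕ → ℕ) (P : Finset (Fin n)) (c : ℕ) : Finset ℕ :=
  P.biUnion fun r => toFilling z r c

theorem mem_toFilling {z : Fin n → ℕ → ℕ} {r : Fin n} {c x : ℕ} :
    x ∈ toFilling z r c ↔ x = z r c ∧ c ≠ 0 ∧ 0 < x := by
  simp [toFilling]

theorem mem_colsOf {z : Fin n → ℕ → ℕ} {P : Finset (Fin n)} {c x : ℕ} :
    x ∈ colsOf z P c ↔ (∃ r ∈ P, z r c = x) ∧ c ≠ 0 ∧ 0 < x := by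
  simp only [colsOf, Finset.mem_biUnion, mem_toFilling]
  exact ⟨fun ⟨r, hr, h, h'⟩ => ⟨⟨r, hr, h.symm⟩, h'⟩, fun ⟨⟨r, hr, h⟩, h'⟩ => ⟨r, hr, h.symm, h'⟩⟩

theorem AtomLike.apply_one {b : Fin n → ℕ} {z : Fin n → ℕ → ℕ} (hA : AtomLike z)
    (hz : IsTable b z) {p : Fin n} (hp : 0 < z p 1) : z p 1 = p.val + 1 := by
  have h0 := hz.anti p 0
  rw [hz.zero, zero_add] at h0
  by_contra hne
  have hlt : z p 1 - 1 < p.val := by omega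
  -- The row whose basement entry is `z p 1` would be forced to have this same number in column `1`.
  have h1 := hA ⟨z p 1 - 1, hlt.trans p.2⟩ p hlt 0
  have h2 := hz.anti ⟨z p 1 - 1, hlt.trans p.2⟩ 0
  rw [hz.zero] at h1 h2
  simp only [zero_add] at h1 h2
  rcases h1 with h1 | h1
  · exact absurd (hz.inj 1 p ⟨z p 1 - 1, hlt.trans p.2⟩ hp (by omega)) (Fin.ne_of_gt hlt)
  · omega

/-- The atom condition says that an entry of a higher row either is at most the next entry of row
`s` or exceeds the current one. So the greatest admissible entry is always that of the lowest row
`s`, and none is admissible once that row ends. -/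
theorem AtomLike.threadEntry_colsOf {b : Fin n → ℕ} {z : Fin n → ℕ → ℕ} (hA : AtomLike z)
    (hz : IsTable b z) {P : Finset (Fin n)} {s : Fin n} (hs : s ∈ P) (hP : ∀ r ∈ P, s ≤ r)
    (hpos : 0 < z s 1) (c : ℕ) :
    threadEntry (colsOf z P) (c + 1) = if 0 < z s (c + 1) then some (z s (c + 1)) else none := by
  induction c with
  | zero =>
    have hmem : z s 1 ∈ colsOf z P 1 := mem_colsOf.2 ⟨⟨s, hs, rfl⟩, one_ne_zero, hpos⟩
    rw [zero_add, threadEntry, dif_pos (show (colsOf z P 1).Nonempty from ⟨_, hmem⟩), if_pos hpos,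
      Option.some_inj, Finset.min'_eq_iff]
    refine ⟨hmem, fun x hx => ?_⟩
    obtain ⟨⟨r, hr, rfl⟩, -, hx⟩ := mem_colsOf.1 hx
    rw [hA.apply_one hz hpos, hA.apply_one hz hx]
    exact Nat.succ_le_succ (hP r hr)
  | succ c ih =>
    rw [threadEntry, ih]
    have hanti := hz.anti s (c + 1)
    by_cases h1 : 0 < z s (c + 1)
    · have hle : ∀ x ∈ (colsOf z P (c + 1 + 1)).filter (· ≤ z s (c + 1)), x ≤ z s (c + 1 + 1) := by
        intro x hx
        obtain ⟨hx, hx'⟩ := Finset.mem_filter.1 hx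
        obtain ⟨⟨r, hr, rfl⟩, -, hx⟩ := mem_colsOf.1 hx
        rcases (hP r hr).eq_or_lt with rfl | hlt
        · exact le_rfl
        · exact (hA s r hlt (c + 1)).resolve_right (not_lt.2 hx')
      simp only [h1, if_true]
      by_cases h2 : 0 < z s (c + 1 + 1)
      · have hmem : z s (c + 1 + 1) ∈ (colsOf z P (c + 1 + 1)).filter (· ≤ z s (c + 1)) :=
          Finset.mem_filter.2 ⟨mem_colsOf.2 ⟨⟨s, hs, rfl⟩, Nat.succ_ne_zero _, h2⟩, hanti⟩
        have hne : ((colsOf z P (c + 2)).filter (· ≤ z s (c + 1))).Nonempty := ⟨_, hmem⟩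
        rw [dif_pos hne, if_pos h2, Option.some_inj, Finset.max'_eq_iff]
        exact ⟨hmem, hle⟩
      · rw [if_neg h2, dif_neg]
        rintro ⟨x, hx⟩
        have := hle x hx
        have := (mem_colsOf.1 (Finset.mem_filter.1 hx).1).2.2
        omega
    · have h2 : ¬ 0 < z s (c + 1 + 1) := by omega
      simp only [h1, h2, if_false]

/-- The rows which are nonempty and have at least `m` nonempty rows below them. -/
def rowsFrom (z : Fin n → ℕ → ℕ) (m : ℕ) : Finset (Fin n) :=
  Finset.univ.filter fun r =>
    0 < z r 1 ∧ m ≤ (Finset.univ.filter fun s => 0 < z s 1 ∧ s < r).card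

theorem rank_lt_rank {z : Fin n → ℕ → ℕ} {r s : Fin n} (hr : 0 < z r 1) (hrs : r < s) :
    (Finset.univ.filter fun t => 0 < z t 1 ∧ t < r).card <
      (Finset.univ.filter fun t => 0 < z t 1 ∧ t < s).card := by
  refine Finset.card_lt_card ((Finset.ssubset_iff_of_subset fun t => ?_).2 ⟨r, ?_, ?_⟩)
  · simp only [Finset.mem_filter, Finset.mem_univ, true_and]
    exact fun h => ⟨h.1, h.2.trans hrs⟩
  · simp [hr, hrs]
  · simp

theorem rank_lt_card {z : Fin n → ℕ → ℕ} {r : Fin n} (hr : 0 < z r 1) :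
    (Finset.univ.filter fun t => 0 < z t 1 ∧ t < r).card <
      (Finset.univ.filter fun t => 0 < z t 1).card := by
  refine Finset.card_lt_card ((Finset.ssubset_iff_of_subset fun t => ?_).2 ⟨r, ?_, ?_⟩)
  · simp only [Finset.mem_filter, Finset.mem_univ, true_and]
    exact fun h => h.1
  · simp [hr]
  · simp

theorem exists_rank_eq {z : Fin n → ℕ → ℕ} {m : ℕ}
    (hm : m < (Finset.univ.filter fun t => 0 < z t 1).card) :
    ∃ r, 0 < z r 1 ∧ (Finset.univ.filter fun t => 0 < z t 1 ∧ t < r).card = m := by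
  have hsurj : Set.SurjOn (fun r : Fin n => (Finset.univ.filter fun t => 0 < z t 1 ∧ t < r).card)
      (Finset.univ.filter fun t => 0 < z t 1 : Finset (Fin n))
      (Finset.range (Finset.univ.filter fun t => 0 < z t 1).card : Finset ℕ) := by
    apply Finset.surjOn_of_injOn_of_card_le
    · intro r hr
      simp only [Finset.coe_filter, Finset.mem_univ, true_and, Set.mem_ofPred_eq] at hr
      simpa using rank_lt_card hr
    · intro r hr s hs h
      simp only [Finset.coe_filter, Finset.mem_univ, true_and, Set.mem_ofPred_eq] at hr hs
      rcases lt_trichotomy r s with hlt | rfl | hlt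
      · exact absurd h (rank_lt_rank hr hlt).ne
      · rfl
      · exact absurd h (rank_lt_rank hs hlt).ne'
    · simp
  obtain ⟨r, hr, h⟩ := hsurj (by simpa using hm : m ∈ _)
  exact ⟨r, by simpa using hr, h⟩

theorem mem_rowsFrom {z : Fin n → ℕ → ℕ} {m : ℕ} {r : Fin n} : r ∈ rowsFrom z m ↔
    0 < z r 1 ∧ m ≤ (Finset.univ.filter fun s => 0 < z s 1 ∧ s < r).card := by
  simp [rowsFrom]

theorem le_of_mem_rowsFrom {z : Fin n → ℕ → ℕ} {m : ℕ} {r s : Fin n} (hr : r ∈ rowsFrom z m)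
    (hs : (Finset.univ.filter fun t => 0 < z t 1 ∧ t < s).card = m) : s ≤ r := by
  obtain ⟨h1, h2⟩ := mem_rowsFrom.1 hr
  by_contra! hlt
  have := rank_lt_rank h1 hlt
  omega

theorem AtomLike.threadEntry_rowsFrom {b : Fin n → ℕ} {z : Fin n → ℕ → ℕ} (hA : AtomLike z)
    (hz : IsTable b z) {m : ℕ} {s : Fin n} (hpos : 0 < z s 1)
    (hs : (Finset.univ.filter fun t => 0 < z t 1 ∧ t < s).card = m) (c : ℕ) :
    threadEntry (colsOf z (rowsFrom z m)) (c + 1) =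
      if 0 < z s (c + 1) then some (z s (c + 1)) else none :=
  hA.threadEntry_colsOf hz (mem_rowsFrom.2 ⟨hpos, hs.ge⟩) (fun _ hr => le_of_mem_rowsFrom hr hs)
    hpos c

/-- Each extraction removes precisely the lowest remaining nonempty row; by injectivity of columns
no other row loses an entry. -/
theorem AtomLike.remaining_colsOf {b : Fin n → ℕ} {z : Fin n → ℕ → ℕ} (hA : AtomLike z)
    (hz : IsTable b z) {m : ℕ} (hm : m ≤ (Finset.univ.filter fun t => 0 < z t 1).card) :
    remaining (colsOf z Finset.univ) m = colsOf z (rowsFrom z m) := by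
  induction m with
  | zero =>
    funext c
    ext x
    simp only [remaining, mem_colsOf, Finset.mem_univ, true_and, mem_rowsFrom, Nat.zero_le,
      and_true]
    refine and_congr_left fun ⟨hc, hx⟩ => exists_congr fun r => (and_iff_right_of_imp ?_).symm
    rintro rfl
    exact (hz.pos r 1).2 ((Nat.one_le_iff_ne_zero.2 hc).trans ((hz.pos r c).1 hx))
  | succ m ih =>
    obtain ⟨s, hs, hsm⟩ := exists_rank_eq (Nat.lt_of_succ_le hm)
    funext c
    rw [remaining, ih (by omega)]
    cases c with
    | zero => simp [Finset.ext_iff, mem_colsOf]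
    | succ c =>
      ext x
      rw [Finset.mem_filter, hA.threadEntry_rowsFrom hz hs hsm, mem_colsOf, mem_colsOf]
      constructor
      · rintro ⟨⟨⟨r, hr, rfl⟩, h⟩, hne⟩
        refine ⟨⟨r, mem_rowsFrom.2 ⟨(mem_rowsFrom.1 hr).1, ?_⟩, rfl⟩, h⟩
        have hsr : s < r := lt_of_le_of_ne (le_of_mem_rowsFrom hr hsm) (by
          rintro rfl
          rw [if_pos h.2] at hne
          exact hne rfl)
        have := rank_lt_rank hs hsr
        omega
      · rintro ⟨⟨r, hr, rfl⟩, h⟩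
        obtain ⟨h1, h2⟩ := mem_rowsFrom.1 hr
        refine ⟨⟨⟨r, mem_rowsFrom.2 ⟨h1, by omega⟩, rfl⟩, h⟩, fun he => ?_⟩
        split_ifs at he with hpos
        have := hz.inj _ _ _ hpos (Option.some_inj.1 he)
        subst this
        omega

/-- This both computes `leftRowFilling` and shows that an atom table is determined by its columns.
The filling `F` is arbitrary, so the algorithm never has to be analysed on key fillings. -/
theorem AtomLike.leftRowFilling_eq {b : Fin n → ℕ} {z : Fin n → ℕ → ℕ} (hA : AtomLike z)
    (hz : IsTable b z) {F : Filling n} (hF : columnSet F = columnSet (toFilling z)) :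
    leftRowFilling F = toFilling z := by
  have hcard : (colsOf z Finset.univ 1).card = (Finset.univ.filter fun t => 0 < z t 1).card := by
    rw [← Finset.card_image_of_injOn (hz.injOn 1 0)]
    congr 1
    ext x
    simp only [mem_colsOf, Finset.mem_image, Finset.mem_filter, Finset.mem_univ, true_and]
    exact ⟨fun ⟨⟨r, h⟩, _, h'⟩ => ⟨r, h ▸ h', h⟩,
      fun ⟨r, h, h'⟩ => ⟨⟨r, h'⟩, one_ne_zero, h' ▸ h⟩⟩
  have hF' : columnSet F = colsOf z Finset.univ := hF
  funext i c
  ext x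
  rw [leftRowFilling, Finset.mem_filter, hF', hcard]
  constructor
  · rintro ⟨hx, m, hm, h1, h2⟩
    obtain ⟨-, hc, hpos⟩ := (mem_colsOf.1 hx)
    obtain ⟨s, hs, hsm⟩ := exists_rank_eq hm
    obtain ⟨c, rfl⟩ := Nat.exists_eq_succ_of_ne_zero hc
    rw [hA.remaining_colsOf hz hm.le, hA.threadEntry_rowsFrom hz hs hsm] at h2
    rw [hA.remaining_colsOf hz hm.le, hA.threadEntry_rowsFrom hz hs hsm 0, if_pos hs,
      hA.apply_one hz hs, Option.some_inj, Nat.succ_inj, ← Fin.ext_iff] at h1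
    subst h1
    split_ifs at h2
    exact mem_toFilling.2 ⟨(Option.some_inj.1 h2).symm, hc, hpos⟩
  · intro hx
    obtain ⟨rfl, hc, hpos⟩ := mem_toFilling.1 hx
    have hi : 0 < z i 1 :=
      (hz.pos i 1).2 ((Nat.one_le_iff_ne_zero.2 hc).trans ((hz.pos i c).1 hpos))
    refine ⟨mem_colsOf.2 ⟨⟨i, Finset.mem_univ _, rfl⟩, hc, hpos⟩, _, rank_lt_card hi, ?_⟩
    obtain ⟨c, rfl⟩ := Nat.exists_eq_succ_of_ne_zero hc
    rw [hA.remaining_colsOf hz (rank_lt_card hi).le, hA.threadEntry_rowsFrom hz hi rfl 0,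
      hA.threadEntry_rowsFrom hz hi rfl, if_pos hi, if_pos hpos, hA.apply_one hz hi]
    exact ⟨rfl, rfl⟩

/-! ### Anchors, free entries and their placement -/

theorem le_anchor {F : Filling n} {i : Fin n} {c x : ℕ} (h : x ∈ F i c) : x ≤ anchor F i c :=
  Finset.le_sup (f := id) h

theorem anchor_mem {F : Filling n} {i : Fin n} {c : ℕ} (h : (F i c).Nonempty) :
    anchor F i c ∈ F i c := by
  obtain ⟨x, hx, h⟩ := Finset.exists_mem_eq_sup _ h id
  rw [anchor, h]
  exact hx

theorem anchor_mem_of_pos {F : Filling n} {i : Fin n} {c : ℕ} (h : 0 < anchor F i c) :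
    anchor F i c ∈ F i c := by
  refine anchor_mem (Finset.nonempty_iff_ne_empty.2 fun h' => ?_)
  simp [anchor, h'] at h

theorem anchor_le {F : Filling n} {i : Fin n} {c m : ℕ} (h : ∀ x ∈ F i c, x ≤ m) :
    anchor F i c ≤ m :=
  Finset.sup_le h

theorem mem_anchors {F : Filling n} {i : Fin n} {c x : ℕ} :
    x ∈ anchors F i c ↔ x ∈ F i c ∧ x = anchor F i c :=
  Finset.mem_filter

theorem anchors_nonempty {F : Filling n} {i : Fin n} {c : ℕ} :
    (anchors F i c).Nonempty ↔ (F i c).Nonempty :=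
  ⟨fun ⟨x, hx⟩ => ⟨x, (mem_anchors.1 hx).1⟩, fun h => ⟨_, mem_anchors.2 ⟨anchor_mem h, rfl⟩⟩⟩

theorem anchor_anchors (F : Filling n) (i : Fin n) (c : ℕ) :
    anchor (anchors F) i c = anchor F i c := by
  refine le_antisymm (anchor_le fun x hx => (mem_anchors.1 hx).2.le)
    (anchor_le fun x hx => (le_anchor hx).trans (le_anchor ?_))
  exact mem_anchors.2 ⟨anchor_mem ⟨x, hx⟩, rfl⟩

theorem singleValued_anchors (F : Filling n) : SingleValued (anchors F) := by
  intro i c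
  rw [Finset.card_le_one]
  intro x hx y hy
  rw [(mem_anchors.1 hx).2, (mem_anchors.1 hy).2]

theorem SingleValued.eq_anchor {F : Filling n} (h : SingleValued F) {i : Fin n} {c x : ℕ}
    (hx : x ∈ F i c) : x = anchor F i c :=
  Finset.card_le_one.1 (h i c) _ hx _ (anchor_mem ⟨x, hx⟩)

theorem SingleValued.anchors_eq {F : Filling n} (h : SingleValued F) : anchors F = F := by
  funext i c
  ext x
  rw [mem_anchors]
  exact and_iff_left_of_imp h.eq_anchor

theorem mem_columnSet {F : Filling n} {c x : ℕ} : x ∈ columnSet F c ↔ ∃ i, x ∈ F i c := by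
  simp [columnSet]

theorem mem_freeSet {F : Filling n} {c x : ℕ} :
    x ∈ freeSet F c ↔ ∃ i, x ∈ F i c ∧ x < anchor F i c := by
  simp [freeSet]

theorem columnSet_eq (F : Filling n) (c : ℕ) :
    columnSet F c = columnSet (anchors F) c ∪ freeSet F c := by
  ext x
  simp only [Finset.mem_union, mem_columnSet, mem_freeSet, mem_anchors, ← exists_or, ← and_or_left]
  exact exists_congr fun i => (and_iff_left_of_imp fun h => (le_anchor h).eq_or_lt).symm

theorem ColumnsDistinct.eq {F : Filling n} (h : ColumnsDistinct F) {i j : Fin n} {c x : ℕ}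
    (hi : x ∈ F i c) (hj : x ∈ F j c) : i = j := by
  by_contra hne
  exact Finset.disjoint_left.1 (h c i j hne) hi hj

theorem ColumnsDistinct.eq_of_anchor {F : Filling n} (h : ColumnsDistinct F) {i j : Fin n} {c : ℕ}
    (hi : 0 < anchor F i c) (hij : anchor F i c = anchor F j c) : i = j :=
  h.eq (anchor_mem_of_pos hi) (hij ▸ anchor_mem_of_pos (hij ▸ hi))

theorem ColumnsDistinct.anchors {F : Filling n} (h : ColumnsDistinct F) :
    ColumnsDistinct (anchors F) :=
  fun c i j hij => Finset.disjoint_of_subset_left (Finset.filter_subset _ _)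
    (Finset.disjoint_of_subset_right (Finset.filter_subset _ _) (h c i j hij))

theorem RowsDecreasing.anchors {F : Filling n} (h : RowsDecreasing F) :
    RowsDecreasing (anchors F) :=
  fun i c x hx y hy => h i c x (mem_anchors.1 hx).1 y (mem_anchors.1 hy).1

theorem RowsDecreasing.anchor_le {F : Filling n} (h : RowsDecreasing F) {i : Fin n} {c x : ℕ}
    (hx : x ∈ F i c) : anchor F i (c + 1) ≤ x :=
  Skyline.anchor_le fun y hy => h i c x hx y hy

/-- Only the box to the right imposes a constraint: anything below the anchor is automatically
compatible with the box to the left. -/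
theorem RowsDecreasing.admits_iff {F : Filling n} (h : RowsDecreasing F) {i : Fin n} {c k : ℕ} :
    Admits F i c k ↔ k < anchor F i c ∧ anchor F i (c + 1) ≤ k := by
  refine and_congr_right fun hk => ⟨fun h' => Skyline.anchor_le fun y hy => ?_, fun h' => ?_⟩
  · exact h' i c k (by simp [addEntry]) y (by simpa [addEntry] using hy)
  · intro i' c' x hx y hy
    unfold addEntry at hx hy
    split_ifs at hx with h1
    · obtain ⟨rfl, rfl⟩ := h1
      rw [if_neg (by simp)] at hy
      rcases Finset.mem_insert.1 hx with rfl | hx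
      · exact (le_anchor hy).trans h'
      · exact h _ _ _ hx _ hy
    · split_ifs at hy with h2
      · obtain ⟨rfl, rfl⟩ := h2
        rcases Finset.mem_insert.1 hy with rfl | hy
        · exact hk.le.trans (h.anchor_le hx)
        · exact h _ _ _ hx _ hy
      · exact h _ _ _ hx _ hy

theorem SingleValued.freeEntriesLeast {F : Filling n} (h : SingleValued F) : FreeEntriesLeast F :=
  fun _ _ _ hk hlt => absurd (h.eq_anchor hk) hlt.ne

open Classical in
/-- Place each element of `U c` in the box of least anchor in column `c` which admits it. -/
noncomputable def placeFree (G : Filling n) (U : ℕ → Finset ℕ) : Filling n :=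
  fun i c => G i c ∪ (U c).filter fun k =>
    Admits G i c k ∧ ∀ j, Admits G j c k → anchor G i c ≤ anchor G j c

theorem mem_placeFree {G : Filling n} {U : ℕ → Finset ℕ} {i : Fin n} {c x : ℕ} :
    x ∈ placeFree G U i c ↔ x ∈ G i c ∨ x ∈ U c ∧ Admits G i c x ∧
      ∀ j, Admits G j c x → anchor G i c ≤ anchor G j c := by
  simp [placeFree]

/-- The conditions on a set-valued filling which do not only concern its anchors. -/
structure IsRegular (F : Filling n) : Prop where
  pos : ∀ i c, ∀ x ∈ F i c, 0 < x
  columnsDistinct : ColumnsDistinct F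
  rowsDecreasing : RowsDecreasing F
  freeEntriesLeast : FreeEntriesLeast F

/-- The elements of `U c` can be placed as free entries in column `c` of `G`. -/
def CanPlace (G : Filling n) (U : ℕ → Finset ℕ) : Prop :=
  ∀ c, ∀ k ∈ U c, 0 < k ∧ k ∉ columnSet G c ∧ ∃ i, Admits G i c k

theorem IsRegular.admits_anchors {F : Filling n} (h : IsRegular F) {i : Fin n} {c k : ℕ} :
    Admits (Skyline.anchors F) i c k ↔ Admits F i c k := by
  rw [h.rowsDecreasing.anchors.admits_iff, h.rowsDecreasing.admits_iff, anchor_anchors,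
    anchor_anchors]

theorem IsRegular.admits_of_mem {F : Filling n} (h : IsRegular F) {i : Fin n} {c k : ℕ}
    (hk : k ∈ F i c) (hlt : k < anchor F i c) : Admits F i c k :=
  h.rowsDecreasing.admits_iff.2 ⟨hlt, h.rowsDecreasing.anchor_le hk⟩

theorem IsRegular.canPlace {F : Filling n} (h : IsRegular F) :
    CanPlace (Skyline.anchors F) (freeSet F) := by
  intro c k hk
  obtain ⟨i, hi, hlt⟩ := mem_freeSet.1 hk
  refine ⟨h.pos i c k hi, fun hk' => ?_, i, h.admits_anchors.2 (h.admits_of_mem hi hlt)⟩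
  obtain ⟨j, hj⟩ := mem_columnSet.1 hk'
  obtain ⟨hj, hja⟩ := mem_anchors.1 hj
  obtain rfl := h.columnsDistinct.eq hi hj
  exact hlt.ne hja

/-- Anchors in a column are distinct, so the box of least anchor admitting a given number is unique.
Hence a regular filling is determined by its anchors and the free sets of its columns. -/
theorem IsRegular.placeFree_anchors {F : Filling n} (h : IsRegular F) :
    placeFree (Skyline.anchors F) (freeSet F) = F := by
  funext i c
  ext x
  simp only [mem_placeFree, h.admits_anchors, anchor_anchors, mem_anchors, mem_freeSet]
  constructor
  · rintro (hx | ⟨⟨j, hj, hlt⟩, hadm, hmin⟩)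
    · exact hx.1
    · have h1 := h.freeEntriesLeast j c x hj hlt i hadm
      have h2 := hmin j (h.admits_of_mem hj hlt)
      obtain rfl := h.columnsDistinct.eq_of_anchor (by omega) (le_antisymm h1 h2)
      exact hj
  · intro hx
    rcases (le_anchor hx).eq_or_lt with heq | hlt
    · exact Or.inl ⟨hx, heq⟩
    · exact Or.inr ⟨⟨i, hx, hlt⟩, h.admits_of_mem hx hlt, h.freeEntriesLeast i c x hx hlt⟩

theorem anchor_placeFree (G : Filling n) (U : ℕ → Finset ℕ) (i : Fin n) (c : ℕ) :
    anchor (placeFree G U) i c = anchor G i c := by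
  refine le_antisymm (anchor_le fun x hx => ?_)
    (anchor_le fun x hx => le_anchor (mem_placeFree.2 (Or.inl hx)))
  rcases mem_placeFree.1 hx with hx | hx
  · exact le_anchor hx
  · exact hx.2.1.1.le

theorem SingleValued.anchors_placeFree {G : Filling n} (hG : SingleValued G)
    (U : ℕ → Finset ℕ) : anchors (placeFree G U) = G := by
  funext i c
  ext x
  rw [mem_anchors, anchor_placeFree, mem_placeFree]
  constructor
  · rintro ⟨hx | hx, hxa⟩
    · exact hx
    · exact absurd hxa hx.2.1.1.ne
  · exact fun hx => ⟨Or.inl hx, hG.eq_anchor hx⟩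

theorem CanPlace.exists_least {G : Filling n} {U : ℕ → Finset ℕ} (hU : CanPlace G U) {c k : ℕ}
    (hk : k ∈ U c) :
    ∃ i, Admits G i c k ∧ ∀ j, Admits G j c k → anchor G i c ≤ anchor G j c := by
  classical
  obtain ⟨i, hi⟩ := (hU c k hk).2.2
  obtain ⟨j, hj, hmin⟩ := Finset.exists_min_image (Finset.univ.filter fun i => Admits G i c k)
    (fun i => anchor G i c) ⟨i, by simpa using hi⟩
  exact ⟨j, by simpa using hj, fun l hl => hmin l (by simpa using hl)⟩

theorem CanPlace.freeSet_placeFree {G : Filling n} (hG : SingleValued G) {U : ℕ → Finset ℕ}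
    (hU : CanPlace G U) : freeSet (placeFree G U) = U := by
  funext c
  ext x
  simp only [mem_freeSet, anchor_placeFree, mem_placeFree]
  constructor
  · rintro ⟨i, hx | hx, hlt⟩
    · exact absurd (hG.eq_anchor hx) hlt.ne
    · exact hx.1
  · intro hx
    obtain ⟨i, hi, hmin⟩ := hU.exists_least hx
    exact ⟨i, Or.inr ⟨hx, hi, hmin⟩, hi.1⟩

theorem CanPlace.isRegular_placeFree {G : Filling n} (hG : SingleValued G) (hR : IsRegular G)
    {U : ℕ → Finset ℕ} (hU : CanPlace G U) : IsRegular (placeFree G U) := by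
  have hrows : RowsDecreasing (placeFree G U) := by
    intro i c x hx y hy
    have h1 : y ≤ anchor G i (c + 1) := anchor_placeFree G U i (c + 1) ▸ le_anchor hy
    refine h1.trans ?_
    rcases mem_placeFree.1 hx with hx | hx
    · exact hR.rowsDecreasing.anchor_le hx
    · exact (hR.rowsDecreasing.admits_iff.1 hx.2.1).2
  refine ⟨fun i c x hx => ?_, fun c i j hij => Finset.disjoint_left.2 fun x hx hx' => ?_, hrows,
    fun i c k hk hlt j hj => ?_⟩
  · rcases mem_placeFree.1 hx with hx | hx
    · exact hR.pos i c x hx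
    · exact (hU c x hx.1).1
  · rcases mem_placeFree.1 hx with h1 | h1 <;> rcases mem_placeFree.1 hx' with h2 | h2
    · exact hij (hR.columnsDistinct.eq h1 h2)
    · exact (hU c x h2.1).2.1 (mem_columnSet.2 ⟨i, h1⟩)
    · exact (hU c x h1.1).2.1 (mem_columnSet.2 ⟨j, h2⟩)
    -- A number placed in two boxes would have equal least anchors there, so the boxes coincide.
    · have := h1.2.1.1
      exact hij (hR.columnsDistinct.eq_of_anchor (by omega)
        (le_antisymm (h1.2.2 j h2.2.1) (h2.2.2 i h1.2.1)))
  · rw [anchor_placeFree] at hlt ⊢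
    rw [anchor_placeFree]
    rw [hrows.admits_iff, anchor_placeFree, anchor_placeFree, ← hR.rowsDecreasing.admits_iff] at hj
    rcases mem_placeFree.1 hk with hk | hk
    · exact absurd (hG.eq_anchor hk) hlt.ne
    · exact hk.2.2 j hj

/-! ### Splitting set-valued fillings into anchors and regularity -/

theorem isFillingOf_iff {a : Fin n → ℕ} {F : Filling n} :
    IsFillingOf a F ↔ IsFillingOf a (anchors F) ∧ ∀ i c, ∀ x ∈ F i c, 0 < x := by
  unfold IsFillingOf
  simp only [anchors_nonempty]
  exact ⟨fun h => ⟨⟨h.1, fun i c x hx => h.2 i c x (mem_anchors.1 hx).1⟩, h.2⟩,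
    fun h => ⟨h.1.1, h.2⟩⟩

theorem isSemistandard_iff {a : Fin n → ℕ} {F : Filling n} : IsSemistandard a F ↔
    IsSemistandard a (anchors F) ∧ ColumnsDistinct F ∧ RowsDecreasing F ∧ FreeEntriesLeast F := by
  have h : TriplesInversion a (anchors F) ↔ TriplesInversion a F := by
    simp only [TriplesInversion, anchor_anchors, anchors_nonempty]
  exact ⟨fun ⟨h1, h2, h3, h4⟩ => ⟨⟨h1.anchors, h2.anchors, h.2 h3,
    (singleValued_anchors F).freeEntriesLeast⟩, h1, h2, h4⟩,
    fun ⟨⟨_, _, h3, _⟩, h1, h2, h4⟩ => ⟨h1, h2, h.1 h3, h4⟩⟩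

theorem mem_lascouxAtomSSF_iff {a : Fin n → ℕ} {F : Filling n} :
    F ∈ lascouxAtomSSF a ↔ anchors F ∈ atomSSF a ∧ IsRegular F := by
  unfold atomSSF lascouxAtomSSF
  simp only [Set.mem_ofPred_eq, anchor_anchors, anchors_nonempty]
  rw [isFillingOf_iff, isSemistandard_iff]
  exact ⟨fun ⟨⟨h1, h2⟩, ⟨h3, h4, h5, h6⟩, h7⟩ =>
    ⟨⟨⟨h1, h3, h7⟩, singleValued_anchors F⟩, h2, h4, h5, h6⟩,
    fun ⟨⟨⟨h1, h3, h7⟩, _⟩, h2, h4, h5, h6⟩ => ⟨⟨h1, h2⟩, ⟨h3, h4, h5, h6⟩, h7⟩⟩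

theorem anchor_withBasement (b : Fin n → ℕ) (F : Filling n) (i : Fin n) {c : ℕ} (hc : c ≠ 0) :
    anchor (withBasement b F) i c = anchor F i c := by
  simp [anchor, withBasement, hc]

theorem anchors_withBasement (b : Fin n → ℕ) (F : Filling n) :
    anchors (withBasement b F) = withBasement b (anchors F) := by
  funext i c
  ext x
  by_cases hc : c = 0
  · simp [anchors, anchor, withBasement, hc]
  · simp only [mem_anchors, anchor_withBasement b F i hc, withBasement, hc, if_false]

theorem mem_lascouxSSF_iff {a : Fin n → ℕ} {F : Filling n} :
    F ∈ lascouxSSF a ↔ anchors F ∈ keySSF a ∧ IsRegular F := by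
  unfold keySSF lascouxSSF
  simp only [Set.mem_ofPred_eq, ← anchors_withBasement]
  generalize (fun i : Fin n => n - i.val) = b
  rw [isFillingOf_iff, isSemistandard_iff]
  constructor
  · rintro ⟨⟨h1, h2⟩, h3, h4, h5, h6⟩
    have h0 : ∀ i, F i 0 = ∅ := fun i => Finset.not_nonempty_iff_eq_empty.1 fun h => by
      simpa using (h1.1 i 0).1 (anchors_nonempty.2 h)
    have hrows : RowsDecreasing F := by
      intro i c x hx y hy
      rcases eq_or_ne c 0 with rfl | hc
      · simp [h0] at hx
      · exact h5 i c x (by simpa [withBasement, hc] using hx) y (by simpa [withBasement] using hy)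
    refine ⟨⟨⟨h1, h3⟩, singleValued_anchors F⟩, h2, fun c i j hij => ?_, hrows,
      fun i c k hk hlt j hj => ?_⟩
    · rcases eq_or_ne c 0 with rfl | hc
      · simp [h0]
      · simpa [withBasement, hc] using h4 c i j hij
    · rcases eq_or_ne c 0 with rfl | hc
      · simp [h0] at hk
      · rw [← anchor_withBasement b F i hc] at hlt ⊢
        rw [← anchor_withBasement b F j hc]
        refine h6 i c k (by simpa [withBasement, hc] using hk) hlt j (h5.admits_iff.2 ?_)
        rw [anchor_withBasement b F j hc, anchor_withBasement b F j (Nat.succ_ne_zero c)]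
        exact hrows.admits_iff.1 hj
  · rintro ⟨⟨⟨h1, h3⟩, -⟩, h2, h4, h5, h6⟩
    have hrows : RowsDecreasing (withBasement b F) := by
      intro i c x hx y hy
      rcases eq_or_ne c 0 with rfl | hc
      -- Regularity says nothing about the basement; it bounds column `1` because it bounds the
      -- anchors there.
      · have h := h3.rowsDecreasing i 0 x (mem_anchors.2 ⟨hx, ?_⟩) (anchor F i 1)
          (mem_anchors.2 ⟨?_, (anchor_withBasement b F i one_ne_zero).symm⟩)
        · exact (le_anchor (F := F) (by simpa [withBasement] using hy)).trans h
        · simpa [withBasement, anchor] using hx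
        · simpa [withBasement] using anchor_mem ⟨y, by simpa [withBasement] using hy⟩
      · exact h5 i c x (by simpa [withBasement, hc] using hx) y (by simpa [withBasement] using hy)
    refine ⟨⟨h1, h2⟩, h3, fun c i j hij => ?_, hrows, fun i c k hk hlt j hj => ?_⟩
    · rcases eq_or_ne c 0 with rfl | hc
      · have h := h3.columnsDistinct 0 i j hij
        simpa [anchors_withBasement, withBasement] using h
      · simpa [withBasement, hc] using h4 c i j hij
    · rcases eq_or_ne c 0 with rfl | hc
      · simp [withBasement, anchor] at hk hlt
        omega
      · rw [hrows.admits_iff, anchor_withBasement b F j hc,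
          anchor_withBasement b F j (Nat.succ_ne_zero c), ← h5.admits_iff] at hj
        rw [anchor_withBasement b F i hc] at hlt ⊢
        rw [anchor_withBasement b F j hc]
        exact h6 i c k (by simpa [withBasement, hc] using hk) hlt j hj

theorem weight_eq {F : Filling n} (h : ColumnsDistinct F) (v : ℕ) :
    weight F v = {c | v ∈ columnSet F c}.ncard := by
  have hinj : Set.InjOn Prod.snd {p : Fin n × ℕ | v ∈ F p.1 p.2} := by
    rintro ⟨i, c⟩ hi ⟨j, d⟩ hj hcd
    obtain rfl : c = d := hcd
    exact Prod.ext (h.eq hi hj) rfl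
  rw [weight, ← hinj.ncard_image]
  congr 1
  ext c
  simp [mem_columnSet]

/-! ### Atom skyline fillings as tables -/

theorem toFilling_nonempty {z : Fin n → ℕ → ℕ} {r : Fin n} {c : ℕ} :
    (toFilling z r c).Nonempty ↔ c ≠ 0 ∧ 0 < z r c :=
  ⟨fun ⟨_, hx⟩ => by obtain ⟨rfl, h⟩ := mem_toFilling.1 hx; exact h,
    fun h => ⟨_, mem_toFilling.2 ⟨rfl, h⟩⟩⟩

theorem anchor_toFilling {z : Fin n → ℕ → ℕ} (r : Fin n) {c : ℕ} (hc : c ≠ 0) :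
    anchor (toFilling z) r c = z r c := by
  refine le_antisymm (anchor_le fun x hx => (mem_toFilling.1 hx).1.le) ?_
  rcases Nat.eq_zero_or_pos (z r c) with h | h
  · omega
  · exact le_anchor (mem_toFilling.2 ⟨rfl, hc, h⟩)

theorem singleValued_toFilling (z : Fin n → ℕ → ℕ) : SingleValued (toFilling z) :=
  fun _ _ => (Finset.card_filter_le _ _).trans (Finset.card_singleton _).le

theorem IsTable.isFillingOf {a : Fin n → ℕ} {z : Fin n → ℕ → ℕ} (hz : IsTable a z) :
    IsFillingOf a (toFilling z) :=
  ⟨fun r c => by rw [toFilling_nonempty, hz.pos, Nat.one_le_iff_ne_zero],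
    fun _ _ _ hx => (mem_toFilling.1 hx).2.2⟩

theorem IsTable.isRegular {a : Fin n → ℕ} {z : Fin n → ℕ → ℕ} (hz : IsTable a z) :
    IsRegular (toFilling z) := by
  refine ⟨fun _ _ _ hx => (mem_toFilling.1 hx).2.2,
    fun c i j hij => Finset.disjoint_left.2 fun x hx hx' => ?_, fun i c x hx y hy => ?_,
    (singleValued_toFilling z).freeEntriesLeast⟩
  · obtain ⟨rfl, -, hpos⟩ := mem_toFilling.1 hx
    exact hij (hz.inj c i j hpos (mem_toFilling.1 hx').1)
  · rw [(mem_toFilling.1 hx).1, (mem_toFilling.1 hy).1]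
    exact hz.anti i c

/-- Once row `j` is weakly below row `i` in some column, the atom condition keeps it so in all later
columns, which is impossible if row `j` is longer. This supplies the type B triples. -/
theorem AtomLike.lt_of_lt {b : Fin n → ℕ} {z : Fin n → ℕ → ℕ} (hA : AtomLike z)
    (hz : IsTable b z) {i j : Fin n} (hij : i < j) (hb : b i < b j) {c : ℕ} (hc : c ≤ b i) :
    z i c < z j (c + 1) := by
  refine (hA i j hij c).resolve_left fun hle => ?_
  have h : ∀ k, z j (c + 1 + k) ≤ z i (c + 1 + k) := by
    intro k
    induction k with
    | zero => exact hle
    | succ k ih =>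
      have h1 := hA i j hij (c + 1 + k)
      have h2 := hz.anti j (c + 1 + k)
      rw [← add_assoc]
      omega
  obtain ⟨k, hk⟩ := Nat.exists_eq_add_of_le (show c + 1 ≤ b j by omega)
  have h1 := h k
  have h2 := hz.pos i (c + 1 + k)
  have h3 := hz.pos j (c + 1 + k)
  omega

theorem AtomLike.mem_atomSSF {b : Fin n → ℕ} {z : Fin n → ℕ → ℕ} (hA : AtomLike z)
    (hz : IsTable b z) : toFilling z ∈ atomSSF b := by
  have hR := hz.isRegular
  refine ⟨⟨hz.isFillingOf, ⟨hR.columnsDistinct, hR.rowsDecreasing, fun i j hij c => ?_,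
    hR.freeEntriesLeast⟩, fun i hi => ?_⟩, singleValued_toFilling z⟩
  · simp only [toFilling_nonempty]
    constructor
    · rintro hle ⟨hc, h1⟩ ⟨-, h2⟩ ⟨-, h3⟩
      rw [anchor_toFilling _ hc, anchor_toFilling _ (Nat.add_one_ne_zero c),
        anchor_toFilling _ (Nat.add_one_ne_zero c)]
      have h4 := hz.anti i c
      rcases hA i j hij c with h | h
      · have : z j (c + 1) ≠ z i (c + 1) := fun h => hij.ne' (hz.inj _ _ _ h3 h)
        exact Or.inl ⟨by omega, h4⟩
      · exact Or.inr ⟨h4, h⟩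
    · rintro hlt ⟨hc, h1⟩ ⟨-, h2⟩ ⟨-, h3⟩
      rw [anchor_toFilling _ hc, anchor_toFilling _ (Nat.add_one_ne_zero c),
        anchor_toFilling _ hc]
      exact Or.inl ⟨hA.lt_of_lt hz hij hlt ((hz.pos i c).1 h3), hz.anti j c⟩
  · rw [anchor_toFilling _ one_ne_zero]
    exact hA.apply_one hz (toFilling_nonempty.1 hi).2

/-- The numbers in a single-valued filling, augmented by a basement with entry `r` in row `r`. -/
def table (F : Filling n) : Fin n → ℕ → ℕ :=
  fun r c => if c = 0 then r.val + 1 else anchor F r c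

theorem toFilling_table {a : Fin n → ℕ} {F : Filling n} (hF : IsFillingOf a F)
    (hs : SingleValued F) : toFilling (table F) = F := by
  funext r c
  ext x
  rw [mem_toFilling]
  constructor
  · rintro ⟨h, hc, hx⟩
    rw [table, if_neg hc] at h
    exact h ▸ anchor_mem_of_pos (h ▸ hx)
  · intro hx
    have hc : c ≠ 0 := Nat.one_le_iff_ne_zero.1 ((hF.1 r c).1 ⟨x, hx⟩).1
    exact ⟨by rw [table, if_neg hc]; exact hs.eq_anchor hx, hc, hF.2 r c x hx⟩

theorem isTable_table {a : Fin n → ℕ} {F : Filling n} (hF : IsFillingOf a F)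
    (hd : ColumnsDistinct F) (hr : RowsDecreasing F) (h1 : ∀ r, anchor F r 1 ≤ r.val + 1) :
    IsTable a (table F) := by
  refine ⟨fun r => by simp [table], fun r c => ?_, fun r c => ?_, fun c q p hq hqp => ?_⟩
  · rcases eq_or_ne c 0 with rfl | hc
    · simpa [table] using h1 r
    · simp only [table, hc, if_false, Nat.add_one_ne_zero]
      rcases Nat.eq_zero_or_pos (anchor F r (c + 1)) with h | h
      · omega
      · have h2 := (hF.1 r (c + 1)).1 ⟨_, anchor_mem_of_pos h⟩
        exact hr.anchor_le (anchor_mem ((hF.1 r c).2 ⟨Nat.one_le_iff_ne_zero.2 hc, by omega⟩))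
  · rcases eq_or_ne c 0 with rfl | hc
    · simp [table]
    · simp only [table, hc, if_false]
      constructor
      · exact fun h => ((hF.1 r c).1 ⟨_, anchor_mem_of_pos h⟩).2
      · exact fun h => hF.2 r c _
          (anchor_mem ((hF.1 r c).2 ⟨Nat.one_le_iff_ne_zero.2 hc, h⟩))
  · rcases eq_or_ne c 0 with rfl | hc
    · exact Fin.ext (by simpa [table] using hqp)
    · simp only [table, hc, if_false] at hq hqp
      exact hd.eq_of_anchor hq hqp

theorem exists_table_of_mem_atomSSF {b : Fin n → ℕ} {F : Filling n} (hF : F ∈ atomSSF b) :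
    ∃ z, IsTable b z ∧ AtomLike z ∧ F = toFilling z := by
  obtain ⟨⟨hF, hS, h1⟩, hs⟩ := hF
  have hz := isTable_table hF hS.columnsDistinct hS.rowsDecreasing fun r => by
    rcases Nat.eq_zero_or_pos (anchor F r 1) with h | h
    · omega
    · exact (h1 r ⟨_, anchor_mem_of_pos h⟩).le
  have heq := toFilling_table hF hs
  have h1' : ∀ r, 0 < table F r 1 → table F r 1 = r.val + 1 := fun r hr => by
    simp only [table, one_ne_zero, if_false] at hr ⊢
    exact h1 r ⟨_, anchor_mem_of_pos hr⟩
  have hT := hS.triplesInversion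
  refine ⟨table F, hz, ?_, heq.symm⟩
  rw [← heq] at hT
  generalize table F = z at hz hT h1'
  intro q p hqp c
  have hqp' : q.val < p.val := hqp
  have hpos := hz.pos
  rcases Nat.eq_zero_or_pos (z p (c + 1)) with h0 | h0
  · omega
  rcases eq_or_ne c 0 with rfl | hc
  · right
    rw [zero_add] at h0 ⊢
    rw [hz.zero, h1' p h0]
    omega
  by_cases hb : b p ≤ b q
  · rcases Nat.eq_zero_or_pos (z q (c + 1)) with h2 | h2
    · have h3 := hpos p (c + 1)
      have h4 := hpos q (c + 1)
      omega
    · have h3 := hz.anti q c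
      have h4 := (hT q p hqp c).1 hb (toFilling_nonempty.2 ⟨hc, by omega⟩)
        (toFilling_nonempty.2 ⟨Nat.add_one_ne_zero c, h2⟩)
        (toFilling_nonempty.2 ⟨Nat.add_one_ne_zero c, h0⟩)
      rw [anchor_toFilling _ hc, anchor_toFilling _ (Nat.add_one_ne_zero c),
        anchor_toFilling _ (Nat.add_one_ne_zero c)] at h4
      rcases h4 with h4 | h4 <;> omega
  · push Not at hb
    have hB : ∀ m, m ≠ 0 → 0 < z q m → z q m < z p (m + 1) ∨ z p m < z q m := by
      intro m hm hq
      have e1 := hpos q m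
      have e2 := hpos p m
      have e3 := hpos p (m + 1)
      have h4 := (hT q p hqp m).2 hb (toFilling_nonempty.2 ⟨hm, by omega⟩)
        (toFilling_nonempty.2 ⟨Nat.add_one_ne_zero m, by omega⟩) (toFilling_nonempty.2 ⟨hm, hq⟩)
      rw [anchor_toFilling _ hm, anchor_toFilling _ (Nat.add_one_ne_zero m),
        anchor_toFilling _ hm] at h4
      rcases h4 with h4 | h4 <;> omega
    -- The first column consists of row indices, which starts an induction along the columns. It
    -- excludes the second alternative in `hB`, leaving the one that is needed.
    have hlt : ∀ m, 0 < z q (m + 1) → z q (m + 1) < z p (m + 1) := by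
      intro m
      induction m with
      | zero =>
        intro hq
        have e1 := hpos q 1
        have e2 := hpos p 1
        rw [zero_add] at hq ⊢
        rw [h1' q hq, h1' p (by omega)]
        omega
      | succ m ih =>
        intro hq
        have e1 := hz.anti q (m + 1)
        have e2 := ih (by omega)
        have e3 := hB (m + 1) (Nat.add_one_ne_zero m) (by omega)
        omega
    obtain ⟨m, rfl⟩ := Nat.exists_eq_succ_of_ne_zero hc
    rcases Nat.eq_zero_or_pos (z q m.succ) with h2 | h2
    · omega
    · have e1 := hlt m h2
      have e2 := hB m.succ hc h2
      rw [← Nat.succ_eq_add_one] at e1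
      omega

/-! ### Key skyline fillings as tables -/

/-- The filling with rows in reversed order. -/
def revRows (F : Filling n) : Filling n := fun i c => F i.rev c

theorem revRows_revRows (F : Filling n) : revRows (revRows F) = F := by
  funext i c; simp [revRows]

theorem anchor_revRows (F : Filling n) (i : Fin n) (c : ℕ) :
    anchor (revRows F) i c = anchor F i.rev c := rfl

theorem columnSet_revRows (F : Filling n) : columnSet (revRows F) = columnSet F := by
  funext c
  ext x
  simp only [mem_columnSet, revRows]
  exact ⟨fun ⟨i, h⟩ => ⟨_, h⟩, fun ⟨i, h⟩ => ⟨i.rev, by simpa using h⟩⟩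

theorem IsRegular.revRows {F : Filling n} (h : IsRegular F) (hs : SingleValued F) :
    IsRegular (revRows F) :=
  ⟨fun i => h.pos i.rev, fun c _ _ hij => h.columnsDistinct c _ _ (Fin.rev_injective.ne hij),
    fun i => h.rowsDecreasing i.rev,
    SingleValued.freeEntriesLeast fun i => hs i.rev⟩

/-- The basement of a key skyline filling. -/
def keyBasement (i : Fin n) : ℕ := n - i.val

theorem anchor_withBasement_revRows {a : Fin n → ℕ} {z : Fin n → ℕ → ℕ} (hz : IsTable a z)
    (i : Fin n) (c : ℕ) :
    anchor (withBasement keyBasement (revRows (toFilling z))) i c = z i.rev c := by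
  rcases eq_or_ne c 0 with rfl | hc
  · simp only [anchor, withBasement, if_true, Finset.sup_singleton, id, hz.zero, keyBasement,
      Fin.val_rev]
    omega
  · rw [anchor_withBasement _ _ _ hc, anchor_revRows, anchor_toFilling _ hc]

theorem withBasement_revRows_nonempty {a : Fin n → ℕ} {z : Fin n → ℕ → ℕ} (hz : IsTable a z)
    {i : Fin n} {c : ℕ} :
    (withBasement keyBasement (revRows (toFilling z)) i c).Nonempty ↔ 0 < z i.rev c := by
  rcases eq_or_ne c 0 with rfl | hc
  · simp [withBasement, hz.zero]
  · simp [withBasement, hc, revRows, toFilling_nonempty]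

theorem IsTable.triplesInversion_iff {a : Fin n → ℕ} {z : Fin n → ℕ → ℕ} (hz : IsTable a z) :
    TriplesInversion (a ∘ Fin.rev) (withBasement keyBasement (revRows (toFilling z))) ↔
      KeyLike a z := by
  simp only [TriplesInversion, anchor_withBasement_revRows hz, withBasement_revRows_nonempty hz,
    Function.comp_apply, IsInversion]
  have hpos := hz.pos
  have hanti := hz.anti
  constructor
  · intro h q p hqp c
    have h' := h p.rev q.rev (Fin.rev_lt_rev.2 hqp)
    simp only [Fin.rev_rev] at h'
    constructor
    · intro hle
      -- The basement orders the two rows, and this order persists: the alternative inversion `z p c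
      -- < z q (c + 1)` contradicts `z q (c + 1) ≤ z q c < z p c`.
      induction c with
      | zero =>
        intro _
        rw [hz.zero, hz.zero]
        exact Nat.succ_lt_succ hqp
      | succ c ih =>
        intro hq
        have e1 := hpos q (c + 1)
        have e2 := hpos p (c + 1)
        have e3 := hanti q c
        have e4 := hanti p c
        have e5 := ih (by omega)
        have e6 := (h' c).1 hle (by omega) (by omega) hq
        omega
    · intro hlt hp hpq
      have e1 := hpos q (c + 1)
      have e2 := hpos p c
      have e3 := (h' c).2 hlt (by omega) (by omega) hp
      omega
  · intro h i j hij c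
    have h' := h j.rev i.rev (Fin.rev_lt_rev.2 hij)
    constructor
    · intro hle h1 h2 h3
      exact Or.inl ⟨(h' (c + 1)).1 hle h3, hanti _ _⟩
    · intro hlt h1 h2 h3
      rcases lt_trichotomy (z i.rev c) (z j.rev c) with h4 | h4 | h4
      · exact Or.inl ⟨(h' c).2 hlt h3 h4, hanti _ _⟩
      · exact absurd (Fin.rev_injective (hz.inj _ _ _ h3 h4)) hij.ne
      · exact Or.inr ⟨hanti _ _, h4⟩

theorem mem_keySSF_iff {a : Fin n → ℕ} {F : Filling n} : F ∈ keySSF a ↔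
    ∃ z, IsTable a z ∧ KeyLike a z ∧ F = revRows (toFilling z) := by
  constructor
  · intro hF
    have hs := hF.2
    have hR := (mem_lascouxSSF_iff.1 hF.1).2
    obtain ⟨⟨hF, hS⟩, -⟩ := hF
    have hF' : IsFillingOf a (revRows F) :=
      ⟨fun i c => by simpa [revRows] using hF.1 i.rev c, fun i => hF.2 i.rev⟩
    have hR' := hR.revRows hs
    have hs' : SingleValued (revRows F) := fun i => hs i.rev
    have hz := isTable_table hF' hR'.columnsDistinct hR'.rowsDecreasing fun r => by
      refine anchor_le fun y hy => ?_
      have := hS.rowsDecreasing r.rev 0 (n - r.rev.val) (by simp [withBasement]) y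
        (by simpa [withBasement, revRows] using hy)
      rw [Fin.val_rev] at this
      omega
    have heq : F = revRows (toFilling (table (revRows F))) := by
      rw [toFilling_table hF' hs', revRows_revRows]
    refine ⟨_, hz, hz.triplesInversion_iff.1 ?_, heq⟩
    rw [← heq]
    exact hS.triplesInversion
  · rintro ⟨z, hz, hk, rfl⟩
    have hs : SingleValued (revRows (toFilling z)) := fun i => singleValued_toFilling z i.rev
    have hR := hz.isRegular.revRows (singleValued_toFilling z)
    have hfill := hz.isFillingOf
    have hs' : SingleValued (withBasement keyBasement (revRows (toFilling z))) := by
      intro i c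
      unfold withBasement
      split_ifs
      · simp
      · exact hs i c
    refine ⟨⟨⟨fun i c => hfill.1 i.rev c, fun i => hfill.2 i.rev⟩, fun c i j hij => ?_,
      fun i c x hx y hy => ?_, hz.triplesInversion_iff.2 hk, hs'.freeEntriesLeast⟩, hs⟩
    · refine Finset.disjoint_left.2 fun x hx hx' => hij (Fin.rev_injective ?_)
      have h1 := hs'.eq_anchor hx
      have h2 := hs'.eq_anchor hx'
      rw [anchor_withBasement_revRows hz] at h1 h2
      exact hz.inj c _ _ ((withBasement_revRows_nonempty hz).1 ⟨x, hx⟩) (h1.symm.trans h2)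
    · have h1 := hs'.eq_anchor hx
      have h2 := hs'.eq_anchor hy
      rw [anchor_withBasement_revRows hz] at h1 h2
      rw [h1, h2]
      exact hz.anti _ _

/-! ### The bijection for single-valued fillings -/

theorem sameColumns_iff {a b : Fin n → ℕ} {z w : Fin n → ℕ → ℕ} (hz : IsTable a z)
    (hw : IsTable b w) :
    SameColumns z w ↔ columnSet (toFilling z) = columnSet (toFilling w) := by
  have hmem : ∀ (u : Fin n → ℕ → ℕ) c x, x ∈ columnSet (toFilling u) c ↔
      (∃ r, u r c = x) ∧ c ≠ 0 ∧ 0 < x := fun u c x =>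
    (mem_colsOf (P := Finset.univ)).trans (by simp only [Finset.mem_univ, true_and])
  constructor
  · intro h
    funext c
    ext x
    rw [hmem, hmem]
    exact and_congr_left fun h' => h c x h'.2
  · intro h c v hv
    rcases eq_or_ne c 0 with rfl | hc
    · simp only [hz.zero, hw.zero]
    · have := congr_arg (v ∈ · c) h
      simpa [hmem, hc, hv] using this

theorem exists_atom_of_mem_keySSF {a : Fin n → ℕ} {T : Filling n} (hT : T ∈ keySSF a) :
    (∃ b ∈ lswap a, leftRowFilling T ∈ atomSSF b) ∧
      columnSet (leftRowFilling T) = columnSet T := by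
  obtain ⟨z, hz, -, rfl⟩ := mem_keySSF_iff.1 hT
  obtain ⟨w, ⟨b, hb, hw, hzw⟩, hA⟩ := exists_atomLike hz
  have hcol : columnSet (revRows (toFilling z)) = columnSet (toFilling w) := by
    rw [columnSet_revRows, (sameColumns_iff hz hw).1 hzw]
  rw [hA.leftRowFilling_eq hw hcol]
  exact ⟨⟨b, hb, hA.mem_atomSSF hw⟩, hcol.symm⟩

theorem injOn_leftRowFilling (a : Fin n → ℕ) :
    Set.InjOn (leftRowFilling : Filling n → Filling n) (keySSF a) := by
  intro T hT T' hT' h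
  have h1 := (exists_atom_of_mem_keySSF hT).2
  have h2 := (exists_atom_of_mem_keySSF hT').2
  rw [h, h2] at h1
  obtain ⟨z, hz, hk, rfl⟩ := mem_keySSF_iff.1 hT
  obtain ⟨w, hw, hkw, rfl⟩ := mem_keySSF_iff.1 hT'
  rw [columnSet_revRows, columnSet_revRows] at h1
  rw [hk.eq hkw ((sameColumns_iff hz hw).2 h1.symm) hz hw]

theorem exists_key_of_mem_atomSSF {a b : Fin n → ℕ} (hb : b ∈ lswap a) {S : Filling n}
    (hS : S ∈ atomSSF b) : ∃ T ∈ keySSF a, leftRowFilling T = S := by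
  obtain ⟨w, hw, hA, rfl⟩ := exists_table_of_mem_atomSSF hS
  obtain ⟨u, hu, hwu⟩ := exists_isTable_of_mem_lswap hb hw
  obtain ⟨z, ⟨hz, huz⟩, hk⟩ := exists_keyLike hu
  refine ⟨_, mem_keySSF_iff.2 ⟨z, hz, hk, rfl⟩, hA.leftRowFilling_eq hw ?_⟩
  rw [columnSet_revRows, (sameColumns_iff hw hz).1 (hwu.trans huz)]

/-! ### Transfer of free entries and the set-valued bijection -/

/-- Some box of column `c` admits `k` exactly when column `c` has more entries exceeding `k` than
column `c + 1`, and these counts are read off the column sets. -/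
theorem exists_admits_of_sameColumns {a b : Fin n → ℕ} {z w : Fin n → ℕ → ℕ} (hz : IsTable a z)
    (hw : IsTable b w) (h : SameColumns z w) {c k : ℕ}
    (hk : ∃ i, Admits (toFilling z) i c k) : ∃ i, Admits (toFilling w) i c k := by
  obtain ⟨i, hi⟩ := hk
  rcases eq_or_ne c 0 with rfl | hc
  · have := hi.1
    simp [anchor, toFilling] at this
  rw [hz.isRegular.rowsDecreasing.admits_iff, anchor_toFilling _ hc,
    anchor_toFilling _ (Nat.add_one_ne_zero c)] at hi
  by_contra! hno
  have h1 : (Finset.univ.filter fun r => k < z r (c + 1)) ⊂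
      Finset.univ.filter fun r => k < z r c := by
    refine (Finset.ssubset_iff_of_subset fun r => ?_).2 ⟨i, by simpa using hi.1, by simpa using hi.2⟩
    simp only [Finset.mem_filter, Finset.mem_univ, true_and]
    exact fun hr => hr.trans_le (hz.anti r c)
  have h2 : (Finset.univ.filter fun r => k < w r c) ⊆
      Finset.univ.filter fun r => k < w r (c + 1) := by
    intro r
    simp only [Finset.mem_filter, Finset.mem_univ, true_and]
    intro hr
    have := hno r
    rw [hw.isRegular.rowsDecreasing.admits_iff, anchor_toFilling _ hc,
      anchor_toFilling _ (Nat.add_one_ne_zero c)] at this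
    omega
  have h3 := Finset.card_lt_card h1
  have h4 := Finset.card_le_card h2
  rw [h.card_filter_lt hz hw, h.card_filter_lt hz hw] at h3
  omega

theorem admits_revRows {z : Fin n → ℕ → ℕ} {a : Fin n → ℕ} (hz : IsTable a z) {i : Fin n}
    {c k : ℕ} : Admits (revRows (toFilling z)) i c k ↔ Admits (toFilling z) i.rev c k := by
  rw [(hz.isRegular.revRows (singleValued_toFilling z)).rowsDecreasing.admits_iff,
    hz.isRegular.rowsDecreasing.admits_iff, anchor_revRows, anchor_revRows]

theorem canPlace_iff {a b : Fin n → ℕ} {T : Filling n} (hT : T ∈ keySSF a)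
    (hS : leftRowFilling T ∈ atomSSF b) (U : ℕ → Finset ℕ) :
    CanPlace T U ↔ CanPlace (leftRowFilling T) U := by
  have hcol := (exists_atom_of_mem_keySSF hT).2
  obtain ⟨z, hz, -, rfl⟩ := mem_keySSF_iff.1 hT
  obtain ⟨w, hw, -, heq⟩ := exists_table_of_mem_atomSSF hS
  unfold CanPlace
  rw [hcol]
  rw [heq, columnSet_revRows] at hcol
  rw [heq]
  have hzw := (sameColumns_iff hz hw).2 hcol.symm
  refine forall₃_congr fun c k _ => and_congr_right fun _ => and_congr_right fun _ => ?_
  simp only [admits_revRows hz]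
  constructor
  · rintro ⟨i, hi⟩
    exact exists_admits_of_sameColumns hz hw hzw ⟨_, hi⟩
  · intro h
    obtain ⟨i, hi⟩ := exists_admits_of_sameColumns hw hz hzw.symm h
    exact ⟨i.rev, by rwa [Fin.rev_rev]⟩

theorem isRegular_of_mem_atomSSF {b : Fin n → ℕ} {S : Filling n} (hS : S ∈ atomSSF b) :
    IsRegular S :=
  (mem_lascouxAtomSSF_iff.1 hS.1).2

theorem isRegular_of_mem_keySSF {a : Fin n → ℕ} {T : Filling n} (hT : T ∈ keySSF a) :
    IsRegular T :=
  (mem_lascouxSSF_iff.1 hT.1).2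

theorem setValuedLeftRowFilling_eq (T : Filling n) :
    setValuedLeftRowFilling T = placeFree (leftRowFilling (anchors T)) (freeSet T) :=
  rfl

theorem exists_lascouxAtom_of_mem_lascouxSSF {a : Fin n → ℕ} {T : Filling n}
    (hT : T ∈ lascouxSSF a) :
    (∃ b ∈ lswap a, setValuedLeftRowFilling T ∈ lascouxAtomSSF b) ∧
      anchors (setValuedLeftRowFilling T) = leftRowFilling (anchors T) ∧
      freeSet (setValuedLeftRowFilling T) = freeSet T := by
  obtain ⟨hA, hR⟩ := mem_lascouxSSF_iff.1 hT
  obtain ⟨b, hb, hS⟩ := (exists_atom_of_mem_keySSF hA).1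
  have hU := (canPlace_iff hA hS _).1 hR.canPlace
  rw [setValuedLeftRowFilling_eq]
  have h1 := hS.2.anchors_placeFree (freeSet T)
  refine ⟨⟨b, hb, mem_lascouxAtomSSF_iff.2 ⟨by rwa [h1], ?_⟩⟩, h1, hU.freeSet_placeFree hS.2⟩
  exact hU.isRegular_placeFree hS.2 (isRegular_of_mem_atomSSF hS)

theorem injOn_setValuedLeftRowFilling (a : Fin n → ℕ) :
    Set.InjOn (setValuedLeftRowFilling : Filling n → Filling n) (lascouxSSF a) := by
  intro T hT T' hT' h
  obtain ⟨-, h1, h2⟩ := exists_lascouxAtom_of_mem_lascouxSSF hT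
  obtain ⟨-, h3, h4⟩ := exists_lascouxAtom_of_mem_lascouxSSF hT'
  obtain ⟨hA, hR⟩ := mem_lascouxSSF_iff.1 hT
  obtain ⟨hA', hR'⟩ := mem_lascouxSSF_iff.1 hT'
  rw [h, h3] at h1
  rw [h, h4] at h2
  rw [← hR.placeFree_anchors, ← hR'.placeFree_anchors, injOn_leftRowFilling a hA' hA h1, h2]

theorem exists_lascoux_of_mem_lascouxAtomSSF {a b : Fin n → ℕ} (hb : b ∈ lswap a)
    {S : Filling n} (hS : S ∈ lascouxAtomSSF b) :
    ∃ T ∈ lascouxSSF a, setValuedLeftRowFilling T = S := by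
  obtain ⟨hA, hR⟩ := mem_lascouxAtomSSF_iff.1 hS
  obtain ⟨T, hT, hTS⟩ := exists_key_of_mem_atomSSF hb hA
  have hU : CanPlace T (freeSet S) := (canPlace_iff hT (hTS ▸ hA) _).2 (hTS ▸ hR.canPlace)
  have h1 := hT.2.anchors_placeFree (freeSet S)
  refine ⟨placeFree T (freeSet S), mem_lascouxSSF_iff.2 ⟨by rwa [h1],
    hU.isRegular_placeFree hT.2 (isRegular_of_mem_keySSF hT)⟩, ?_⟩
  rw [setValuedLeftRowFilling_eq, h1, hU.freeSet_placeFree hT.2, hTS, hR.placeFree_anchors]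

theorem columnSet_setValuedLeftRowFilling {a : Fin n → ℕ} {T : Filling n}
    (hT : T ∈ lascouxSSF a) : columnSet (setValuedLeftRowFilling T) = columnSet T := by
  obtain ⟨-, h1, h2⟩ := exists_lascouxAtom_of_mem_lascouxSSF hT
  funext c
  rw [columnSet_eq, columnSet_eq T, h1, h2,
    (exists_atom_of_mem_keySSF (mem_lascouxSSF_iff.1 hT).1).2]

theorem setValuedLeftRowFilling_eq_leftRowFilling {a : Fin n → ℕ} {T : Filling n}
    (hT : T ∈ keySSF a) : setValuedLeftRowFilling T = leftRowFilling T := by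
  obtain ⟨b, -, hS⟩ := (exists_atom_of_mem_keySSF hT).1
  have hfree : freeSet T = fun _ => ∅ := by
    funext c
    refine Finset.eq_empty_of_forall_notMem fun x hx => ?_
    obtain ⟨i, hi, hlt⟩ := mem_freeSet.1 hx
    exact hlt.ne (hT.2.eq_anchor hi)
  rw [setValuedLeftRowFilling_eq, hT.2.anchors_eq, hfree]
  funext i c
  simp [placeFree]

theorem IsFillingOf.shape_eq {a b : Fin n → ℕ} {F : Filling n} (ha : IsFillingOf a F)
    (hb : IsFillingOf b F) : a = b := by
  funext i
  have h := fun c => (ha.1 i c).symm.trans (hb.1 i c)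
  have h1 := h (a i)
  have h2 := h (b i)
  omega

/-- A filling determines its shape, so the union over shapes is disjoint and the index carries no
extra information. -/
theorem sigma_ext {L : Set (Fin n → ℕ)} {A : (Fin n → ℕ) → Set (Filling n)}
    (hA : ∀ b, ∀ F ∈ A b, IsFillingOf b F) {x y : Σ b : L, A b.1} (h : x.2.1 = y.2.1) :
    x = y := by
  obtain ⟨⟨b, hb⟩, F, hF⟩ := x
  obtain ⟨⟨b', hb'⟩, F', hF'⟩ := y
  obtain rfl : F = F' := h
  obtain rfl : b = b' := (hA b F hF).shape_eq (hA b' F hF')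
  rfl

theorem exists_equiv_sigma {K : Set (Filling n)} {L : Set (Fin n → ℕ)}
    {A : (Fin n → ℕ) → Set (Filling n)} (hA : ∀ b, ∀ F ∈ A b, IsFillingOf b F)
    {f : Filling n → Filling n} (hmap : ∀ T ∈ K, ∃ b ∈ L, f T ∈ A b) (hinj : Set.InjOn f K)
    (hsurj : ∀ b ∈ L, ∀ S ∈ A b, ∃ T ∈ K, f T = S) :
    ∃ e : K ≃ Σ b : L, A b.1, ∀ T, (e T).2.1 = f T.1 := by
  choose g hg hg' using hmap
  let e : K → Σ b : L, A b.1 := fun T => ⟨⟨g T.1 T.2, hg T.1 T.2⟩, f T.1, hg' T.1 T.2⟩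
  refine ⟨Equiv.ofBijective e ⟨fun T T' h => ?_, fun y => ?_⟩, fun T => rfl⟩
  · exact Subtype.ext (hinj T.2 T'.2 (congr_arg (fun x : Σ b : L, A b.1 => x.2.1) h))
  · obtain ⟨T, hT, h⟩ := hsurj _ y.1.2 _ y.2.2
    exact ⟨⟨T, hT⟩, sigma_ext hA h⟩

end Skyline

theorem mainTheorem5 (n : ℕ) (a : Fin n → ℕ) :
    ∃ (ψ : Skyline.keySSF a ≃ Σ b : Skyline.lswap a, Skyline.atomSSF b.1)
      (ψbar : Skyline.lascouxSSF a ≃ Σ b : Skyline.lswap a, Skyline.lascouxAtomSSF b.1),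
      (∀ T : Skyline.keySSF a,
        (ψ T).2.1 = Skyline.leftRowFilling T.1 ∧
        (∀ c, Skyline.columnSet (ψ T).2.1 c = Skyline.columnSet T.1 c) ∧
        Skyline.weight (ψ T).2.1 = Skyline.weight T.1) ∧
      (∀ T : Skyline.lascouxSSF a,
        (ψbar T).2.1 = Skyline.setValuedLeftRowFilling T.1 ∧
        (∀ c, Skyline.columnSet (ψbar T).2.1 c = Skyline.columnSet T.1 c) ∧
        Skyline.weight (ψbar T).2.1 = Skyline.weight T.1) ∧
      (∀ T : Skyline.keySSF a,
        (ψbar ⟨T.1, T.2.1⟩).1 = (ψ T).1 ∧ (ψbar ⟨T.1, T.2.1⟩).2.1 = (ψ T).2.1) := by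
  open Skyline in
  have hfill : ∀ b : Fin n → ℕ, ∀ F ∈ lascouxAtomSSF b, IsFillingOf b F := fun b F hF => hF.1
  obtain ⟨ψ, hψ⟩ := exists_equiv_sigma (A := atomSSF) (fun b F hF => hfill b F hF.1)
    (fun T hT => (exists_atom_of_mem_keySSF hT).1) (injOn_leftRowFilling a)
    (fun b hb S hS => exists_key_of_mem_atomSSF hb hS)
  obtain ⟨ψbar, hψbar⟩ := exists_equiv_sigma (A := lascouxAtomSSF) hfill
    (fun T hT => (exists_lascouxAtom_of_mem_lascouxSSF hT).1) (injOn_setValuedLeftRowFilling a)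
    (fun b hb S hS => exists_lascoux_of_mem_lascouxAtomSSF hb hS)
  have hweight : ∀ {F G : Filling n}, IsRegular F → IsRegular G → columnSet F = columnSet G →
      weight F = weight G := fun hF hG h => funext fun v => by
    rw [weight_eq hF.columnsDistinct, weight_eq hG.columnsDistinct, h]
  refine ⟨ψ, ψbar, fun T => ?_, fun T => ?_, fun T => ?_⟩
  · have hcol : columnSet (ψ T).2.1 = columnSet T.1 := by
      rw [hψ, (exists_atom_of_mem_keySSF T.2).2]
    exact ⟨hψ T, fun c => congr_fun hcol c, hweight (isRegular_of_mem_atomSSF (ψ T).2.2)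
      (isRegular_of_mem_keySSF T.2) hcol⟩
  · have hcol : columnSet (ψbar T).2.1 = columnSet T.1 := by
      rw [hψbar, columnSet_setValuedLeftRowFilling T.2]
    exact ⟨hψbar T, fun c => congr_fun hcol c,
      hweight (mem_lascouxAtomSSF_iff.1 (ψbar T).2.2).2 (mem_lascouxSSF_iff.1 T.2).2 hcol⟩
  · have h : (ψbar ⟨T.1, T.2.1⟩).2.1 = (ψ T).2.1 := by
      rw [hψbar, hψ, setValuedLeftRowFilling_eq_leftRowFilling T.2]
    refine ⟨Subtype.ext ((hfill _ _ (ψbar ⟨T.1, T.2.1⟩).2.2).shape_eq ?_), h⟩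
    rw [h]
    exact hfill _ _ (ψ T).2.2.1
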